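/- Let $n\in\{1,2\}$ and let $T=\mathbb R^{n+1}/\pi\mathbb Z^{n+1}$, with $[y]\in T$ the class of $y\in\mathbb R^{n+1}$. Let $p_0=0$ and $p_k=\frac{\pi}{2}e_k$ for $k=1,\dots,n+1$, where $(e_k)$ is the standard basis, and let $\Delta$ be the open $(n+1)$-simplex with vertices $p_0,\dots,p_{n+1}$. Let $C^+\subset T$ be the set of classes of the points of $\Delta\cup\{p_0,\dots,p_{n+1}\}$, let $C^-=-C^+$, and let $C=C^+\cup C^-$ (the Lagrangian coamoeba, with vertices $[p_0],\dots,[p_{n+1}]$). Define $F:C\to\mathbb R$ by $$F(y)=\Big(\cos\Big(\sum_{j=1}^{n+1}y_j\Big)\prod_{j=1}^{n+1}\sin y_j\Big)^{\frac1{n+1}}\ \text{on } C^+,\qquad F(y)=(-1)^n\Big(\cos\Big(\sum_{j=1}^{n+1}y_j\Big)\prod_{j=1}^{n+1}\sin y_j\Big)^{\frac1{n+1}}\ \text{on } C^-,$$ with real roots (for even $n$ the odd root of a negative number is negative). Let $\pi:\tilde C\to C$ be the real blow-up of $C$ at its vertices. As a set, $\tilde C$ consists of the points of $C$ which are not vertices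 and, over each vertex $[p_k]$, of the lines $\ell\subset\mathbb R^{n+1}$ through the origin such that $p_k+\ell$ meets $\Delta$. It is a smooth manifold: for each $k$, if $v_1,\dots,v_{n+1}$ are the vectors $p_i-p_k$ $(i\ne k)$, there is a chart with coordinates $(\alpha_1,\dots,\alpha_n,t)$, where $\alpha_i>0$ and $|t|(1+\sum_i\alpha_i)<1$; with $v=\alpha_1v_1+\dots+\alpha_nv_n+v_{n+1}$, it parametrizes the point $[p_k+tv]$ if $t\neq0$ and the line $\mathbb Rv$ over $[p_k]$ if $t=0$. For $k=1,\dots,n+1$ let $R_k^*:\mathbb R^{n+1}\to\mathbb R^{n+1}$ be the linear map whose $k$-th component is $-x_k$ and whose $j$-th component is $x_j-x_k$ for $j\neq k$. Put $$\mathcal H_0=\Big\{x\in\mathbb R^{n+1}: x_j\ge0\ \text{for all } j,\ x_1\cdots x_{n+1}\le\tfrac1{(n+1)^{n+1}}\Big\},\qquad \mathcal H_k=R_k^*\mathcal H_0,\qquad \mathcal H=\bigcup_{k=0}^{n+1}\mathcal H_k .$$ Then the map $(F_{y_1},\dots,F_{y_{n+1}})$, defined on $C$ minus its vertices, has a unique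 extension to a smooth map $\mathbf h:\tilde C\to\mathbb R^{n+1}$. The image of $\mathbf h$ is $\mathcal H$. Moreover $\mathbf h$ restricts to a diffeomorphism from $\operatorname{int}C^+$ (identified with its preimage in $\tilde C$) onto $\operatorname{int}\mathcal H$. -/

import Mathlib

open Set Real
open scoped Manifold ContDiff

attribute [local instance 2000] chartedSpaceSelf

namespace LagrangianPants

/-- The space `ℝ^{n+1}` of coordinates `y` on `N_ℝ`, or of dual coordinates `x` on `M_ℝ`. -/
abbrev Vec (n : ℕ) : Type := Fin (n + 1) → ℝ

/-- The lattice `π ℤ^{n+1}`. -/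
noncomputable def lattice (n : ℕ) : AddSubgroup (Vec n) :=
  AddSubgroup.pi Set.univ (fun _ => AddSubgroup.zmultiples π)

/-- The torus `T = ℝ^{n+1} / π ℤ^{n+1}`. -/
abbrev Torus (n : ℕ) : Type := Vec n ⧸ lattice n

/-- The class `[y] ∈ T` of `y ∈ ℝ^{n+1}`. -/
noncomputable def toTorus {n : ℕ} (y : Vec n) : Torus n := QuotientAddGroup.mk y

/-- The points `p_0 = 0` and `p_k = (π/2) e_k`, `k = 1, …, n+1`. -/
noncomputable def vertex {n : ℕ} : Fin (n + 2) → Vec n :=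
  Fin.cons 0 (fun i => Pi.single i (π / 2))

/-- The point `∑ᵢ wᵢ pᵢ`. -/
noncomputable def comb {n : ℕ} (w : Fin (n + 2) → ℝ) : Vec n := ∑ i, w i • vertex i

/-- The open standard simplex of barycentric coordinates. -/
def openBary (n : ℕ) : Set (Fin (n + 2) → ℝ) := {b | (∀ i, 0 < b i) ∧ ∑ i, b i = 1}

/-- The open `(n+1)`-simplex in `ℝ^{n+1}` with vertices `p_0, …, p_{n+1}`. -/
def openSimplex (n : ℕ) : Set (Vec n) := comb '' openBary n

/-- The vertices `[p_0], …, [p_{n+1}]` of the coamoeba. -/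
def coamoebaVertices (n : ℕ) : Set (Torus n) := range (fun k => toTorus (vertex (n := n) k))

/-- `C⁺`: the classes of the vertices and of the points of the open simplex. -/
def coamoebaPos (n : ℕ) : Set (Torus n) := toTorus '' (range vertex ∪ openSimplex n)

/-- `C⁻ = -C⁺`. -/
def coamoebaNeg (n : ℕ) : Set (Torus n) := (fun q => -q) '' coamoebaPos n

/-- The Lagrangian coamoeba `C = C⁺ ∪ C⁻`. -/
def coamoeba (n : ℕ) : Set (Torus n) := coamoebaPos n ∪ coamoebaNeg n

/-! ### The function `F` and its differential -/

/-- `cos (y_1 + ⋯ + y_{n+1}) · sin y_1 ⋯ sin y_{n+1}`. -/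
noncomputable def cosSin {n : ℕ} (y : Vec n) : ℝ := cos (∑ j, y j) * ∏ j, sin (y j)

theorem cosSin_congr {n : ℕ} (a b : Vec n) (h : -a + b ∈ lattice n) : cosSin a = cosSin b := by
  have h1 : ∀ j, ∃ m : ℤ, b j = a j + m * π := by
    intro j
    obtain ⟨m, hm⟩ := AddSubgroup.mem_zmultiples_iff.1 (h j (mem_univ j))
    refine ⟨m, ?_⟩
    simp only [zsmul_eq_mul, Pi.add_apply, Pi.neg_apply] at hm
    linarith
  choose m hm using h1
  have h2 : ∑ j, b j = ∑ j, a j + ((∑ j, m j : ℤ) : ℝ) * π := by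
    push_cast
    rw [Finset.sum_mul, ← Finset.sum_add_distrib]
    exact Finset.sum_congr rfl fun j _ => hm j
  have h3 : ∏ j, sin (b j) = (-1 : ℝ) ^ (∑ j, m j) * ∏ j, sin (a j) := by
    have : (-1 : ℝ) ^ (∑ j, m j) = ∏ j, (-1 : ℝ) ^ (m j) := by
      induction (Finset.univ : Finset (Fin (n + 1))) using Finset.induction_on with
      | empty => simp
      | insert i s hi ih =>
        rw [Finset.sum_insert hi, Finset.prod_insert hi, zpow_add₀ (by norm_num), ih]
    rw [this, ← Finset.prod_mul_distrib]
    exact Finset.prod_congr rfl fun j _ => by rw [hm j, sin_add_int_mul_pi]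
  unfold cosSin
  rw [h2, h3, cos_add_int_mul_pi]
  have : ((-1 : ℝ) ^ (∑ j, m j)) * ((-1 : ℝ) ^ (∑ j, m j)) = 1 := by
    rw [← mul_zpow]; norm_num
  linear_combination (-(cos (∑ j, a j) * ∏ j, sin (a j))) * this

/-- `cosSin` as a function on the torus. -/
noncomputable def torusCosSin {n : ℕ} (q : Torus n) : ℝ :=
  Quotient.liftOn' q cosSin
    (fun a b h => cosSin_congr a b (QuotientAddGroup.leftRel_apply.1 h))

/-- The real `m`-th root of `x`, for `x ≥ 0`, and also for `x < 0` when `m` is odd. -/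
noncomputable def realRoot (m : ℕ) (x : ℝ) : ℝ := SignType.sign x * |x| ^ (1 / (m : ℝ))

open Classical in
/-- The function `F` on the coamoeba, with value `0` (never used) outside it. -/
noncomputable def F {n : ℕ} (q : Torus n) : ℝ :=
  if q ∈ coamoebaPos n then realRoot (n + 1) (torusCosSin q)
  else if q ∈ coamoebaNeg n then (-1) ^ n * realRoot (n + 1) (torusCosSin q)
  else 0

/-- `(F_{y_1}, …, F_{y_{n+1}})` at a point of the torus. -/
noncomputable def dF {n : ℕ} (q : Torus n) : Vec n :=
  fun j => deriv (fun s : ℝ => F (q + toTorus (Pi.single j s))) 0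

/-! ### The blow-up of the coamoeba at its vertices -/

/-- The real blow-up `C̃` of `C` at its vertices, as a set: the points of `C` which are not vertices,
and, over each vertex `p_k`, the lines `ℓ` through the origin such that the line `p_k + ℓ` meets the
open simplex. -/
inductive BlownUpCoamoeba (n : ℕ) : Type
  | base (q : Torus n) (hq : q ∈ coamoeba n \ coamoebaVertices n) : BlownUpCoamoeba n
  | exc (k : Fin (n + 2)) (l : Submodule ℝ (Vec n))
      (hl : ∃ y ∈ openSimplex n, l = Submodule.span ℝ {y - vertex k}) : BlownUpCoamoeba n

/-- The projection `C̃ → C ⊆ T`. -/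
noncomputable def BlownUpCoamoeba.proj {n : ℕ} : BlownUpCoamoeba n → Torus n
  | .base q _ => q
  | .exc k _ _ => toTorus (vertex k)

/-- `(α_1, …, α_n, t) ↦ (α_1, …, α_n, 1)`. -/
def slope {n : ℕ} (c : Vec n) : Fin (n + 1) → ℝ := Fin.snoc (fun i : Fin n => c i.castSucc) 1

/-- `(α_1, …, α_n, t) ↦ ∑ᵢ αᵢ eᵢ` with `α_{n+1} = 1`, where `e_1, …, e_{n+1}` are the edges of the
simplex which start at the vertex `p_k`. -/
noncomputable def direction {n : ℕ} (k : Fin (n + 2)) (c : Vec n) : Vec n :=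
  ∑ i, slope c i • (vertex (k.succAbove i) - vertex k)

/-- The range of the coordinates `(α_1, …, α_n, t)`: all `αᵢ > 0`, and `|t|` so small that
`p_k + |t| v` lies in the open simplex (for `t ≠ 0`), where `v` is the direction given by `α`. -/
def coordDomain (n : ℕ) : Set (Vec n) :=
  {c | (∀ i : Fin n, 0 < c i.castSucc) ∧ |c (Fin.last n)| * ∑ i, slope c i < 1}

/-- Barycentric coordinates of `p_k + s v`, where `v` is the direction given by `c`. -/
def bary {n : ℕ} (k : Fin (n + 2)) (s : ℝ) (c : Vec n) : Fin (n + 2) → ℝ :=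
  k.insertNth (1 - s * ∑ i, slope c i) (fun i => s * slope c i)

theorem slope_pos {n : ℕ} {c : Vec n} (hc : c ∈ coordDomain n) (i : Fin (n + 1)) :
    0 < slope c i := by
  refine Fin.lastCases ?_ (fun i => ?_) i
  · simp [slope]
  · simpa [slope] using hc.1 i

theorem slope_sum_pos {n : ℕ} {c : Vec n} (hc : c ∈ coordDomain n) : 0 < ∑ i, slope c i :=
  Finset.sum_pos (fun i _ => slope_pos hc i) Finset.univ_nonempty

theorem comb_apply {n : ℕ} (w : Fin (n + 2) → ℝ) (j : Fin (n + 1)) :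
    comb w j = w j.succ * (π / 2) := by
  simp [comb, vertex, Fin.sum_univ_succ, Finset.sum_apply, Pi.single_apply]

theorem comb_inj {n : ℕ} {w w' : Fin (n + 2) → ℝ} (hs : ∑ i, w i = ∑ i, w' i)
    (h : comb w = comb w') : w = w' := by
  have h1 : ∀ j : Fin (n + 1), w j.succ = w' j.succ := by
    intro j
    have := congrFun h j
    rw [comb_apply, comb_apply] at this
    exact mul_right_cancel₀ (by positivity) this
  funext i
  refine Fin.cases ?_ h1 i
  have hs' : ∑ j : Fin (n + 1), w j.succ = ∑ j : Fin (n + 1), w' j.succ :=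
    Finset.sum_congr rfl fun j _ => h1 j
  rw [Fin.sum_univ_succ, Fin.sum_univ_succ w'] at hs
  linarith

theorem comb_insertNth {n : ℕ} (k : Fin (n + 2)) (x : ℝ) (a : Fin (n + 1) → ℝ) :
    comb (k.insertNth x a : Fin (n + 2) → ℝ) =
      x • vertex k + ∑ i, a i • vertex (k.succAbove i) := by
  simp [comb, Fin.sum_univ_succAbove _ k]

theorem sum_insertNth {n : ℕ} (k : Fin (n + 2)) (x : ℝ) (a : Fin (n + 1) → ℝ) :
    ∑ i, (k.insertNth x a : Fin (n + 2) → ℝ) i = x + ∑ i, a i := by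
  simp [Fin.sum_univ_succAbove _ k]

theorem comb_bary {n : ℕ} (k : Fin (n + 2)) (s : ℝ) (c : Vec n) :
    comb (bary k s c) = vertex k + s • direction k c := by
  rw [bary, comb_insertNth, direction]
  simp only [smul_sub, Finset.sum_sub_distrib, Finset.smul_sum, smul_smul, sub_smul, one_smul,
    ← Finset.sum_smul]
  abel

theorem bary_mem {n : ℕ} (k : Fin (n + 2)) {s : ℝ} (hs : 0 < s) {c : Vec n}
    (hc : c ∈ coordDomain n) (h : s * ∑ i, slope c i < 1) : bary k s c ∈ openBary n := by
  refine ⟨fun i => ?_, ?_⟩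
  · refine Fin.succAboveCases k ?_ (fun i => ?_) i
    · simp only [bary, Fin.insertNth_apply_same]; linarith
    · simp only [bary, Fin.insertNth_apply_succAbove]; exact mul_pos hs (slope_pos hc i)
  · rw [bary, sum_insertNth, ← Finset.mul_sum]; ring

/-- The point `[± ∑ᵢ bᵢ pᵢ]` of the torus, with sign `σ`. -/
noncomputable def signedPoint {n : ℕ} (σ : SignType) (b : Fin (n + 2) → ℝ) : Torus n :=
  toTorus ((σ : ℝ) • comb b)

theorem toTorus_eq {n : ℕ} {y y' : Vec n} (h : toTorus y = toTorus y') (j : Fin (n + 1)) :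
    ∃ m : ℤ, y' j = y j + m * π := by
  obtain ⟨m, hm⟩ := AddSubgroup.mem_zmultiples_iff.1 (QuotientAddGroup.eq.1 h j (mem_univ j))
  refine ⟨m, ?_⟩
  simp only [zsmul_eq_mul, Pi.add_apply, Pi.neg_apply] at hm
  linarith

theorem openBary_lt_one {n : ℕ} {b : Fin (n + 2) → ℝ} (hb : b ∈ openBary n) (j : Fin (n + 1)) :
    b j.succ < 1 := by
  have h := hb.2
  rw [Fin.sum_univ_succ] at h
  have := Finset.single_le_sum (f := fun i : Fin (n + 1) => b i.succ)
    (fun i _ => (hb.1 i.succ).le) (Finset.mem_univ j)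
  have h0 := hb.1 0
  linarith

theorem signedPoint_inj {n : ℕ} {σ σ' : SignType} {b b' : Fin (n + 2) → ℝ} (hσ : σ ≠ 0)
    (hσ' : σ' ≠ 0) (hb : b ∈ openBary n) (hb' : b' ∈ openBary n)
    (h : signedPoint σ b = signedPoint σ' b') : σ = σ' ∧ b = b' := by
  have key : ∀ j : Fin (n + 1), ∃ m : ℤ, (σ' : ℝ) * b' j.succ = σ * b j.succ + 2 * m := by
    intro j
    obtain ⟨m, hm⟩ := toTorus_eq h j
    refine ⟨m, ?_⟩
    simp only [Pi.smul_apply, comb_apply, smul_eq_mul] at hm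
    have hp := pi_pos
    have h2 : ((σ' : ℝ) * b' j.succ - σ * b j.succ - 2 * m) * (π / 2) = 0 := by linarith
    rcases mul_eq_zero.1 h2 with h3 | h3 <;> linarith
  have hss : σ = σ' := by
    obtain ⟨m, hm⟩ := key 0
    have h1 := hb.1 (0 : Fin (n + 1)).succ
    have h2 := hb'.1 (0 : Fin (n + 1)).succ
    have h3 := openBary_lt_one hb 0
    have h4 := openBary_lt_one hb' 0
    simp only [Fin.succ_zero_eq_one] at h1 h2 h3 h4
    cases σ <;> cases σ' <;> simp at hσ hσ' hm ⊢
    · have a1 : (0 : ℝ) < m := by linarith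
      have a2 : (m : ℝ) < 1 := by linarith
      have a1' : 0 < m := by exact_mod_cast a1
      have a2' : m < 1 := by exact_mod_cast a2
      omega
    · have a1 : (m : ℝ) < 0 := by linarith
      have a2 : (-1 : ℝ) < m := by linarith
      have a1' : m < 0 := by exact_mod_cast a1
      have a2' : -1 < m := by exact_mod_cast a2
      omega
  subst hss
  refine ⟨rfl, comb_inj (hb.2.trans hb'.2.symm) ?_⟩
  funext j
  obtain ⟨m, hm⟩ := key j
  have h1 := hb.1 j.succ
  have h2 := hb'.1 j.succ
  have h3 := openBary_lt_one hb j
  have h4 := openBary_lt_one hb' j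
  have hm0 : (-1 : ℝ) < m ∧ (m : ℝ) < 1 := by
    cases σ <;> simp at hσ hm ⊢ <;> constructor <;> linarith
  have hm1 : m = 0 := by
    have a1' : -1 < m := by exact_mod_cast hm0.1
    have a2' : m < 1 := by exact_mod_cast hm0.2
    omega
  subst hm1
  rw [comb_apply, comb_apply]
  cases σ <;> simp at hσ hm ⊢ <;> exact hm.symm

theorem signedPoint_not_vertex {n : ℕ} {σ : SignType} {b : Fin (n + 2) → ℝ} (hσ : σ ≠ 0)
    (hb : b ∈ openBary n) : signedPoint σ b ∉ coamoebaVertices n := by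
  rintro ⟨k, hk⟩
  have fin : ∀ (j : Fin (n + 1)) (e : ℤ), (e = 0 ∨ e = 1) →
      (vertex k : Vec n) j = e * (π / 2) → False := by
    intro j e he hv
    obtain ⟨m, hm⟩ := toTorus_eq hk j
    simp only [Pi.smul_apply, comb_apply, smul_eq_mul, hv] at hm
    have h2 : ((σ : ℝ) * b j.succ - e - 2 * m) * (π / 2) = 0 := by linarith
    have hp := pi_pos
    have h1 := hb.1 j.succ
    have h3 := openBary_lt_one hb j
    have h4 : (σ : ℝ) * b j.succ = ((e + 2 * m : ℤ) : ℝ) := by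
      push_cast
      rcases mul_eq_zero.1 h2 with h5 | h5 <;> linarith
    cases σ <;> simp at hσ h4
    · have a1 : ((e + 2 * m : ℤ) : ℝ) < 0 := by push_cast; linarith
      have a2 : (-1 : ℝ) < ((e + 2 * m : ℤ) : ℝ) := by push_cast; linarith
      have a1' : e + 2 * m < 0 := by exact_mod_cast a1
      have a2' : -1 < e + 2 * m := by exact_mod_cast a2
      omega
    · have a1 : (0 : ℝ) < ((e + 2 * m : ℤ) : ℝ) := by push_cast; linarith
      have a2 : ((e + 2 * m : ℤ) : ℝ) < 1 := by push_cast; linarith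
      have a1' : 0 < e + 2 * m := by exact_mod_cast a1
      have a2' : e + 2 * m < 1 := by exact_mod_cast a2
      omega
  refine Fin.cases (fun h => ?_) (fun i h => ?_) k (motive := fun k' => k = k' → False) rfl
  · subst h
    exact fin 0 0 (Or.inl rfl) (by simp [vertex])
  · subst h
    exact fin i 1 (Or.inr rfl) (by simp [vertex])

theorem signedPoint_mem {n : ℕ} {σ : SignType} {b : Fin (n + 2) → ℝ} (hσ : σ ≠ 0)
    (hb : b ∈ openBary n) : signedPoint σ b ∈ coamoeba n \ coamoebaVertices n := by
  refine ⟨?_, signedPoint_not_vertex hσ hb⟩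
  cases σ
  · exact absurd rfl hσ
  · refine Or.inr ⟨toTorus (comb b), ⟨comb b, Or.inr ⟨b, hb, rfl⟩, rfl⟩, ?_⟩
    simp [signedPoint, toTorus]
  · refine Or.inl ⟨comb b, Or.inr ⟨b, hb, rfl⟩, ?_⟩
    simp [signedPoint]

theorem toTorus_two_vertex {n : ℕ} (k : Fin (n + 2)) (y : Vec n) :
    toTorus (vertex k - y) = toTorus (-(vertex k + y)) := by
  refine QuotientAddGroup.eq.2 fun j _ => ?_
  refine AddSubgroup.mem_zmultiples_iff.2 ?_
  refine Fin.cases ?_ (fun i => ?_) k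
  · exact ⟨0, by simp [vertex]⟩
  · by_cases h : j = i
    · subst h
      exact ⟨-1, by simp [vertex]; ring⟩
    · exact ⟨0, by simp [vertex, h]⟩

theorem toTorus_param {n : ℕ} (k : Fin (n + 2)) {c : Vec n} (ht : c (Fin.last n) ≠ 0) :
    toTorus (vertex k + c (Fin.last n) • direction k c) =
      signedPoint (SignType.sign (c (Fin.last n))) (bary k |c (Fin.last n)| c) := by
  rw [signedPoint, comb_bary]
  rcases lt_or_gt_of_ne ht with h | h
  · rw [abs_of_neg h, sign_neg h]
    have := toTorus_two_vertex k (-c (Fin.last n) • direction k c)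
    simp only [neg_smul, sub_neg_eq_add] at this
    simp [this, add_comm]
  · rw [abs_of_pos h, sign_pos h]; simp

theorem param_mem {n : ℕ} (k : Fin (n + 2)) {c : Vec n} (hc : c ∈ coordDomain n)
    (ht : c (Fin.last n) ≠ 0) : toTorus (vertex k + c (Fin.last n) • direction k c) ∈
      coamoeba n \ coamoebaVertices n := by
  rw [toTorus_param k ht]
  exact signedPoint_mem (by simpa using ht) (bary_mem k (abs_pos.2 ht) hc hc.2)

theorem direction_mem {n : ℕ} (k : Fin (n + 2)) {c : Vec n} (hc : c ∈ coordDomain n) :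
    ∃ y ∈ openSimplex n,
      Submodule.span ℝ {direction k c} = Submodule.span ℝ {y - vertex k} := by
  have hS := slope_sum_pos hc
  have hs : 0 < 1 / (2 * ∑ i, slope c i) := by positivity
  refine ⟨_, ⟨bary k (1 / (2 * ∑ i, slope c i)) c, bary_mem k hs hc ?_, rfl⟩, ?_⟩
  · field_simp; norm_num
  · rw [comb_bary, add_sub_cancel_left]
    exact (Submodule.span_singleton_smul_eq (isUnit_iff_ne_zero.2 hs.ne') _).symm

instance {n : ℕ} : Nonempty (BlownUpCoamoeba n) := by
  have hc : (Fin.snoc (fun _ : Fin n => (1 : ℝ)) (0 : ℝ) : Vec n) ∈ coordDomain n := by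
    constructor <;> simp
  exact ⟨.exc 0 _ (direction_mem 0 hc)⟩

open Classical in
/-- The coordinates `(α, t)` of `C̃` around the fibre over the vertex `p_k` (inverse of a chart):
if `v` is the direction given by `α`, then `(α, t)` stands for `[p_k + t v]` if `t ≠ 0`, and for the
line spanned by `v` over `p_k` if `t = 0`. Only the values on `coordDomain n` matter. -/
noncomputable def param {n : ℕ} (k : Fin (n + 2)) (c : Vec n) : BlownUpCoamoeba n :=
  if hc : c ∈ coordDomain n then
    if ht : c (Fin.last n) = 0 then
      .exc k (Submodule.span ℝ {direction k c}) (direction_mem k hc)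
    else .base (toTorus (vertex k + c (Fin.last n) • direction k c)) (param_mem k hc ht)
  else Classical.arbitrary _

theorem slope_inj {n : ℕ} {c c' : Vec n} (h : slope c = slope c')
    (ht : c (Fin.last n) = c' (Fin.last n)) : c = c' := by
  funext i
  refine Fin.lastCases ht (fun i => ?_) i
  simpa [slope] using congrFun h i.castSucc

theorem direction_inj {n : ℕ} {k : Fin (n + 2)} {c c' : Vec n} {r : ℝ}
    (h : r • direction k c = direction k c') : slope c = slope c' := by
  have h1 : comb (bary k r c) = comb (bary k 1 c') := by
    rw [comb_bary, comb_bary, one_smul, h]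
  have h0 : ∑ i, bary k r c i = ∑ i, bary k 1 c' i := by
    simp only [bary, sum_insertNth, ← Finset.mul_sum]
    ring
  have h2 := comb_inj h0 h1
  have h3 : ∀ i, r * slope c i = slope c' i := fun i => by
    simpa [bary] using congrFun h2 (k.succAbove i)
  have hr : r = 1 := by simpa [slope] using h3 (Fin.last n)
  funext i
  simpa [hr] using h3 i

theorem param_injOn {n : ℕ} (k : Fin (n + 2)) : InjOn (param k) (coordDomain n) := by
  intro c hc c' hc' h
  unfold param at h
  rw [dif_pos hc, dif_pos hc'] at h
  by_cases ht : c (Fin.last n) = 0 <;> by_cases ht' : c' (Fin.last n) = 0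
  · rw [dif_pos ht, dif_pos ht'] at h
    injection h with _ h
    have h1 : direction k c' ∈ Submodule.span ℝ {direction k c} := by
      rw [h]; exact Submodule.mem_span_singleton_self _
    obtain ⟨r, hr⟩ := Submodule.mem_span_singleton.1 h1
    exact slope_inj (direction_inj hr) (ht.trans ht'.symm)
  · rw [dif_pos ht, dif_neg ht'] at h; cases h
  · rw [dif_neg ht, dif_pos ht'] at h; cases h
  · rw [dif_neg ht, dif_neg ht'] at h
    injection h with h
    rw [toTorus_param k ht, toTorus_param k ht'] at h
    obtain ⟨h1, h2⟩ := signedPoint_inj (by simpa using ht) (by simpa using ht')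
      (bary_mem k (abs_pos.2 ht) hc hc.2) (bary_mem k (abs_pos.2 ht') hc' hc'.2) h
    have h3 : ∀ i, |c (Fin.last n)| * slope c i = |c' (Fin.last n)| * slope c' i := fun i => by
      simpa [bary] using congrFun h2 (k.succAbove i)
    have h4 : |c (Fin.last n)| = |c' (Fin.last n)| := by simpa [slope] using h3 (Fin.last n)
    refine slope_inj ?_ ?_
    · funext i
      have := h3 i
      rw [h4] at this
      exact mul_left_cancel₀ (abs_pos.2 ht').ne' this
    · rw [← sign_mul_abs (c (Fin.last n)), ← sign_mul_abs (c' (Fin.last n)), h1, h4]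

/-- The chart of `C̃` around the fibre over `p_k`. -/
noncomputable def chart {n : ℕ} (k : Fin (n + 2)) : PartialEquiv (BlownUpCoamoeba n) (Vec n) :=
  (Set.InjOn.toPartialEquiv (param k) (coordDomain n) (param_injOn k)).symm

/-- The coordinates in the `j`-th chart of the point `[± ∑ᵢ bᵢ pᵢ]`. -/
noncomputable def coords {n : ℕ} (j : Fin (n + 2)) (σ : SignType) (b : Fin (n + 2) → ℝ) : Vec n :=
  Fin.snoc (fun i : Fin n => b (j.succAbove i.castSucc) / b (j.succAbove (Fin.last n)))
    (σ * b (j.succAbove (Fin.last n)))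

theorem slope_coords {n : ℕ} (j : Fin (n + 2)) (σ : SignType) {b : Fin (n + 2) → ℝ}
    (hb : b ∈ openBary n) (i : Fin (n + 1)) :
    slope (coords j σ b) i = b (j.succAbove i) / b (j.succAbove (Fin.last n)) := by
  refine Fin.lastCases ?_ (fun i => ?_) i
  · simp [slope, (hb.1 _).ne']
  · simp [slope, coords]

theorem abs_coords {n : ℕ} (j : Fin (n + 2)) {σ : SignType} (hσ : σ ≠ 0) {b : Fin (n + 2) → ℝ}
    (hb : b ∈ openBary n) :
    |coords j σ b (Fin.last n)| = b (j.succAbove (Fin.last n)) := by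
  have := hb.1 (j.succAbove (Fin.last n))
  cases σ <;> simp [coords, abs_of_pos this] at hσ ⊢

theorem sign_coords {n : ℕ} (j : Fin (n + 2)) {σ : SignType} {b : Fin (n + 2) → ℝ}
    (hb : b ∈ openBary n) :
    SignType.sign (coords j σ b (Fin.last n)) = σ := by
  have := hb.1 (j.succAbove (Fin.last n))
  cases σ <;> simp [coords, this, sign_pos]

theorem bary_coords {n : ℕ} (j : Fin (n + 2)) {σ : SignType} {b : Fin (n + 2) → ℝ}
    (hb : b ∈ openBary n) :
    bary j (b (j.succAbove (Fin.last n))) (coords j σ b) = b := by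
  have h0 := (hb.1 (j.succAbove (Fin.last n))).ne'
  have h1 : ∀ i, b (j.succAbove (Fin.last n)) * slope (coords j σ b) i = b (j.succAbove i) := by
    intro i
    rw [slope_coords j σ hb]
    field_simp
  have h2 := hb.2
  rw [Fin.sum_univ_succAbove _ j] at h2
  funext i
  refine Fin.succAboveCases j ?_ (fun i => ?_) i
  · rw [bary, Fin.insertNth_apply_same, Finset.mul_sum, Finset.sum_congr rfl fun i _ => h1 i]
    linarith
  · rw [bary, Fin.insertNth_apply_succAbove, h1]

theorem coords_mem {n : ℕ} (j : Fin (n + 2)) {σ : SignType} (hσ : σ ≠ 0) {b : Fin (n + 2) → ℝ}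
    (hb : b ∈ openBary n) : coords j σ b ∈ coordDomain n := by
  refine ⟨fun i => ?_, ?_⟩
  · simpa [coords] using div_pos (hb.1 _) (hb.1 _)
  · rw [abs_coords j hσ hb]
    have h := congrFun (bary_coords j (σ := σ) hb) j
    rw [bary, Fin.insertNth_apply_same] at h
    have := hb.1 j
    linarith

theorem param_of_ne {n : ℕ} (k : Fin (n + 2)) {c : Vec n} (hc : c ∈ coordDomain n)
    (ht : c (Fin.last n) ≠ 0) : param k c =
      .base (signedPoint (SignType.sign (c (Fin.last n))) (bary k |c (Fin.last n)| c))
        (signedPoint_mem (by simpa using ht) (bary_mem k (abs_pos.2 ht) hc hc.2)) := by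
  unfold param
  rw [dif_pos hc, dif_neg ht]
  congr 1
  exact toTorus_param k ht

theorem coords_ne {n : ℕ} (j : Fin (n + 2)) {σ : SignType} (hσ : σ ≠ 0) {b : Fin (n + 2) → ℝ}
    (hb : b ∈ openBary n) : coords j σ b (Fin.last n) ≠ 0 := by
  intro h
  have := abs_coords j hσ hb
  rw [h, abs_zero] at this
  exact (hb.1 _).ne this

theorem param_coords {n : ℕ} (j : Fin (n + 2)) {σ : SignType} (hσ : σ ≠ 0)
    {b : Fin (n + 2) → ℝ} (hb : b ∈ openBary n) :
    param j (coords j σ b) = .base (signedPoint σ b) (signedPoint_mem hσ hb) := by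
  rw [param_of_ne j (coords_mem j hσ hb) (coords_ne j hσ hb)]
  congr 1
  rw [sign_coords j hb, abs_coords j hσ hb, bary_coords j hb]

theorem exists_signedPoint {n : ℕ} {q : Torus n} (hq : q ∈ coamoeba n \ coamoebaVertices n) :
    ∃ σ : SignType, σ ≠ 0 ∧ ∃ b ∈ openBary n, q = signedPoint σ b := by
  obtain ⟨hq1, hq2⟩ := hq
  rcases hq1 with ⟨y, hy | ⟨b, hb, rfl⟩, rfl⟩ | ⟨_, ⟨y, hy | ⟨b, hb, rfl⟩, rfl⟩, rfl⟩
  · obtain ⟨k, rfl⟩ := hy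
    exact absurd ⟨k, rfl⟩ hq2
  · exact ⟨1, by decide, b, hb, by simp [signedPoint]⟩
  · obtain ⟨k, rfl⟩ := hy
    refine absurd ⟨k, ?_⟩ hq2
    have := toTorus_two_vertex k (0 : Vec n)
    simp only [sub_zero, add_zero] at this
    simpa [toTorus] using this
  · exact ⟨-1, by decide, b, hb, by simp [signedPoint, toTorus]⟩

/-- The change of coordinates from the `k`-th to the `j`-th chart (`j ≠ k`), where `t ≠ 0`. -/
noncomputable def change {n : ℕ} (k j : Fin (n + 2)) (c : Vec n) : Vec n :=
  coords j (SignType.sign (c (Fin.last n))) (bary k |c (Fin.last n)| c)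

theorem param_change {n : ℕ} (k j : Fin (n + 2)) {c : Vec n} (hc : c ∈ coordDomain n)
    (ht : c (Fin.last n) ≠ 0) : change k j c ∈ coordDomain n ∧ param j (change k j c) = param k c :=
  ⟨coords_mem j (by simpa using ht) (bary_mem k (abs_pos.2 ht) hc hc.2), by
    rw [param_of_ne k hc ht, change,
      param_coords j (by simpa using ht) (bary_mem k (abs_pos.2 ht) hc hc.2)]⟩

theorem chart_param {n : ℕ} (j : Fin (n + 2)) {c : Vec n} (hc : c ∈ coordDomain n) :
    chart j (param j c) = c :=
  (Set.InjOn.toPartialEquiv (param j) (coordDomain n) (param_injOn j)).left_inv hc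

theorem contDiff_slope {n : ℕ} (i : Fin (n + 1)) : ContDiff ℝ ∞ (fun c : Vec n => slope c i) := by
  refine Fin.lastCases ?_ (fun i => ?_) i
  · simpa [slope] using contDiff_const
  · simpa [slope] using contDiff_apply ℝ ℝ i.castSucc

theorem isOpen_coordDomain (n : ℕ) : IsOpen (coordDomain n) := by
  have h1 : IsOpen (⋂ i : Fin n, {c : Vec n | 0 < c i.castSucc}) :=
    isOpen_iInter_of_finite fun i => isOpen_lt continuous_const (continuous_apply _)
  have h2 : coordDomain n = (⋂ i : Fin n, {c : Vec n | 0 < c i.castSucc}) ∩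
      {c | |c (Fin.last n)| * ∑ i, slope c i < 1} := by
    ext c
    simp [coordDomain]
  rw [h2]
  refine h1.inter ?_
  refine isOpen_lt (Continuous.mul ((continuous_apply _).abs) ?_) continuous_const
  exact continuous_finsetSum _ fun i _ => (contDiff_slope i).continuous

theorem contDiffAt_change {n : ℕ} (k j : Fin (n + 2)) {c : Vec n} (hc : c ∈ coordDomain n)
    (ht : c (Fin.last n) ≠ 0) : ContDiffAt ℝ ∞ (change k j) c := by
  have hb := bary_mem k (abs_pos.2 ht) hc hc.2
  have hlast : ContDiffAt ℝ ∞ (fun c : Vec n => |c (Fin.last n)|) c :=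
    (contDiffAt_abs ht).comp c (contDiff_apply ℝ ℝ (Fin.last n)).contDiffAt
  have hbary : ∀ i, ContDiffAt ℝ ∞ (fun c : Vec n => bary k |c (Fin.last n)| c i) c := by
    intro i
    refine Fin.succAboveCases k ?_ (fun i => ?_) i
    · simp only [bary, Fin.insertNth_apply_same]
      exact contDiffAt_const.sub (hlast.mul
        (ContDiffAt.sum fun i _ => (contDiff_slope i).contDiffAt))
    · simp only [bary, Fin.insertNth_apply_succAbove]
      exact hlast.mul (contDiff_slope i).contDiffAt
  have hsign : ContDiffAt ℝ ∞ (fun c : Vec n => ((SignType.sign (c (Fin.last n)) : SignType) : ℝ)) c := by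
    have hcont : Filter.Tendsto (fun c : Vec n => c (Fin.last n)) (nhds c) (nhds (c (Fin.last n))) :=
      (continuous_apply (Fin.last n)).continuousAt
    refine (contDiffAt_const (c := ((SignType.sign (c (Fin.last n)) : SignType) : ℝ))).congr_of_eventuallyEq ?_
    rcases lt_or_gt_of_ne ht with h | h
    · filter_upwards [hcont.eventually (gt_mem_nhds h)] with c' hc'
      rw [sign_neg h, sign_neg hc']
    · filter_upwards [hcont.eventually (lt_mem_nhds h)] with c' hc'
      rw [sign_pos h, sign_pos hc']
  rw [contDiffAt_pi]
  intro i
  refine Fin.lastCases ?_ (fun i => ?_) i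
  · simp only [change, coords, Fin.snoc_last]
    exact hsign.mul (hbary _)
  · simp only [change, coords, Fin.snoc_castSucc]
    exact (hbary _).div (hbary _) (hb.1 _).ne'

theorem change_source {n : ℕ} (k j : Fin (n + 2)) :
    ((chart k).symm.trans (chart j)).source =
      coordDomain n ∩ {c | k = j ∨ c (Fin.last n) ≠ 0} := by
  ext c
  rw [PartialEquiv.trans_source]
  change (c ∈ coordDomain n ∧ param k c ∈ param j '' coordDomain n) ↔ _
  refine and_congr_right fun hc => ⟨?_, ?_⟩
  · rintro ⟨c', hc', h⟩
    by_contra! hcon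
    obtain ⟨hkj, ht⟩ : k ≠ j ∧ c (Fin.last n) = 0 := by simpa using hcon
    unfold param at h
    rw [dif_pos hc, dif_pos hc', dif_pos ht] at h
    by_cases ht' : c' (Fin.last n) = 0
    · rw [dif_pos ht'] at h
      injection h with h
      exact hkj h.symm
    · rw [dif_neg ht'] at h
      cases h
  · rintro (rfl | ht)
    · exact ⟨c, hc, rfl⟩
    · exact ⟨change k j c, param_change k j hc ht⟩

theorem isOpen_change_source {n : ℕ} (k j : Fin (n + 2)) :
    IsOpen ((chart k).symm.trans (chart j)).source := by
  rw [change_source]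
  refine (isOpen_coordDomain n).inter ?_
  by_cases h : k = j
  · simp [h]
  · simpa [h] using isOpen_ne_fun (continuous_apply (Fin.last n)) (continuous_const (y := (0 : ℝ)))

theorem contDiffOn_change {n : ℕ} (k j : Fin (n + 2)) :
    ContDiffOn ℝ ∞ ((chart k).symm.trans (chart j)) ((chart k).symm.trans (chart j)).source := by
  rw [change_source]
  rintro c ⟨hc, hc'⟩
  by_cases h : k = j
  · subst h
    refine contDiffWithinAt_id.congr (fun x hx => chart_param k hx.1) (chart_param k hc)
  · have ht : c (Fin.last n) ≠ 0 := hc'.resolve_left h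
    refine (contDiffAt_change k j hc ht).contDiffWithinAt.congr (fun x hx => ?_) ?_
    · obtain ⟨h1, h2⟩ := param_change k j hx.1 (hx.2.resolve_left h)
      change chart j (param k x) = _
      rw [← h2, chart_param j h1]
    · obtain ⟨h1, h2⟩ := param_change k j hc ht
      change chart j (param k c) = _
      rw [← h2, chart_param j h1]

theorem mem_chart_source_base {n : ℕ} (j : Fin (n + 2)) {q : Torus n}
    (hq : q ∈ coamoeba n \ coamoebaVertices n) :
    BlownUpCoamoeba.base q hq ∈ (chart j).source := by
  obtain ⟨σ, hσ, b, hb, rfl⟩ := exists_signedPoint hq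
  exact ⟨coords j σ b, coords_mem j hσ hb, param_coords j hσ hb⟩

theorem mem_chart_source_exc {n : ℕ} (k : Fin (n + 2)) {l : Submodule ℝ (Vec n)}
    (hl : ∃ y ∈ openSimplex n, l = Submodule.span ℝ {y - vertex k}) :
    BlownUpCoamoeba.exc k l hl ∈ (chart k).source := by
  obtain ⟨_, ⟨b, hb, rfl⟩, rfl⟩ := id hl
  let c : Vec n := Fin.snoc
    (fun i : Fin n => b (k.succAbove i.castSucc) / b (k.succAbove (Fin.last n))) 0
  have hs : slope c = slope (coords k 1 b) := by
    funext i
    refine Fin.lastCases ?_ (fun i => ?_) i <;> simp [slope, c, coords]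
  have hc : c ∈ coordDomain n := by
    refine ⟨fun i => ?_, by simp [c]⟩
    simpa [c] using div_pos (hb.1 _) (hb.1 _)
  refine ⟨c, hc, ?_⟩
  have ht : c (Fin.last n) = 0 := by simp [c]
  unfold param
  rw [dif_pos hc, dif_pos ht]
  have hd : comb b - vertex k = b (k.succAbove (Fin.last n)) • direction k c := by
    have := comb_bary k (b (k.succAbove (Fin.last n))) (coords k 1 b)
    rw [bary_coords k hb] at this
    rw [this, add_sub_cancel_left, direction, direction, hs]
  congr 1
  rw [hd]
  exact (Submodule.span_singleton_smul_eq (isUnit_iff_ne_zero.2 (hb.1 _).ne') _).symm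

/-- An index of a chart which contains the given point of `C̃`. -/
def BlownUpCoamoeba.index {n : ℕ} : BlownUpCoamoeba n → Fin (n + 2)
  | .base _ _ => 0
  | .exc k _ _ => k

/-- The atlas of `C̃` given by the coordinates `(α, t)` around the fibres over the vertices. -/
noncomputable def blowUpCore (n : ℕ) : ChartedSpaceCore (Vec n) (BlownUpCoamoeba n) where
  atlas := range chart
  chartAt z := chart z.index
  mem_chart_source := by
    rintro (⟨q, hq⟩ | ⟨k, l, hl⟩)
    · exact mem_chart_source_base 0 hq
    · exact mem_chart_source_exc k hl
  chart_mem_atlas z := ⟨z.index, rfl⟩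
  open_source := by
    rintro _ _ ⟨k, rfl⟩ ⟨j, rfl⟩
    exact isOpen_change_source k j
  continuousOn_toFun := by
    rintro _ _ ⟨k, rfl⟩ ⟨j, rfl⟩
    exact (contDiffOn_change k j).continuousOn

noncomputable instance (n : ℕ) : TopologicalSpace (BlownUpCoamoeba n) :=
  (blowUpCore n).toTopologicalSpace

noncomputable instance (n : ℕ) : ChartedSpace (Vec n) (BlownUpCoamoeba n) :=
  (blowUpCore n).toChartedSpace

instance (n : ℕ) : IsManifold 𝓘(ℝ, Vec n) ∞ (BlownUpCoamoeba n) := by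
  refine isManifold_of_contDiffOn _ _ _ ?_
  intro e e' he he'
  obtain ⟨e₀, he₀⟩ := mem_iUnion.1 he
  obtain ⟨h1, he₀⟩ := mem_iUnion.1 he₀
  obtain ⟨e₁, he₁⟩ := mem_iUnion.1 he'
  obtain ⟨h2, he₁⟩ := mem_iUnion.1 he₁
  rw [mem_singleton_iff] at he₀ he₁
  subst he₀ he₁
  obtain ⟨k, rfl⟩ := h1
  obtain ⟨j, rfl⟩ := h2
  simp only [modelWithCornersSelf_coe, modelWithCornersSelf_coe_symm, range_id, inter_univ,
    preimage_id]
  exact contDiffOn_change k j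

/-! ### The Lagrangian amoeba -/

/-- `R*_k` for `k = 1, …, n+1`:
`x ↦ (x_1 - x_k, …, x_{k-1} - x_k, -x_k, x_{k+1} - x_k, …, x_{n+1} - x_k)`. -/
def reflection {n : ℕ} (k : Fin (n + 1)) (x : Vec n) : Vec n :=
  fun j => if j = k then -x k else x j - x k

/-- `𝓗_0`. -/
def amoebaZero (n : ℕ) : Set (Vec n) :=
  {x | (∀ j, 0 ≤ x j) ∧ ∏ j, x j ≤ 1 / ((n : ℝ) + 1) ^ (n + 1)}

/-- `𝓗 = 𝓗_0 ∪ ⋃_{k=1}^{n+1} R*_k 𝓗_0`. -/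
def amoeba (n : ℕ) : Set (Vec n) := amoebaZero n ∪ ⋃ k, reflection k '' amoebaZero n

/-- `h` is the smooth extension to `C̃` of the map `(F_{y_1}, …, F_{y_{n+1}})`, which is defined on
`C` minus its vertices. -/
def IsSmoothExtension {n : ℕ} (h : BlownUpCoamoeba n → Vec n) : Prop :=
  ContMDiff 𝓘(ℝ, Vec n) 𝓘(ℝ, Vec n) ∞ h ∧
    ∀ (q : Torus n) (hq : q ∈ coamoeba n \ coamoebaVertices n), h (.base q hq) = dF q

/-- The subset of `C̃` which is identified with `int C⁺` by the projection. -/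
def posInterior (n : ℕ) : Set (BlownUpCoamoeba n) :=
  BlownUpCoamoeba.proj ⁻¹' interior (coamoebaPos n)

end LagrangianPants

open LagrangianPants

/-! Put `Y_0 = π/2 - ∑ y_j` and `Y_j = y_j`. On the open simplex these are `n + 2` positive angles
with sum `π/2`, and `F = (∏ sin Y_i)^{1/(n+1)}`, a symmetric function of the `Y_i`. Its partial
derivatives in the `y_j` are the differences `g_j - g_0`, where `g_i = F/(n+1) · cot Y_i`. On `C⁻`
one has `F([-y]) = -F([y])`, so the gradient takes the same value at `[y]` and `[-y]`, and it
suffices to study the simplex.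

Diffeomorphism. `F` is strictly concave on the simplex: with `v_i = U_i / sin Y_i`, the second
derivative in a direction `U` with `∑ U_i = 0` is negative by `sq_sum_cos_mul_lt`. Hence the
gradient is injective with invertible differential, so it is a diffeomorphism onto an open set.

Image of the simplex. With `x_0 = 0` adjoined, `𝓗` is the set of `x` for which `∏_{i≠k} (x_i - x_k)
≤ (n+1)^{-(n+1)}` whenever `x_k` is minimal (`mem_amoeba_iff`). A gradient satisfies this strictly,
by a direct computation (`grad_mem_strictAmoeba`). Conversely, given `x` satisfying it strictly,
maximize `F(y) - ⟨x, y⟩` over the closed simplex. On the boundary `F = 0`, and near `p_k` the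
function exceeds every boundary value (`exists_rootSin_gt`), so the maximum is interior and its
gradient is `x` (`image_grad`). The strict region is thus open, and a dilation argument identifies
it with `int 𝓗`.

Blow-up. Near `p_k` the angles other than `Y_k` are `t w_i`. Writing `sin (t w) = t w sinc (t w)`,
the factor `t` in `F` cancels the pole of `cot (t w_i)`. The result is smooth across `t = 0` and
even in `t`, so it matches the gradient on both `C⁺` and `C⁻`. At `t = 0` the gaps `x_i - x_k` are
proportional to `1 / w_i` and their product is exactly `(n+1)^{-(n+1)}`; every such system of gaps
occurs, so the exceptional fibres fill `𝓗 \ int 𝓗`. Uniqueness holds because every exceptional point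
is a limit of non-exceptional ones. -/

namespace LagrangianPants

/-! ### The root of a product of sines and its gradient -/

/-- `(∏ sin Yᵢ)^{1/(n+1)}` for `n + 2` angles `Yᵢ`. -/
noncomputable def rootSin {n : ℕ} (Y : Fin (n + 2) → ℝ) : ℝ :=
  (∏ i, sin (Y i)) ^ (1 / ((n : ℝ) + 1))

/-- The gradient of `rootSin`. -/
noncomputable def cotField {n : ℕ} (Y : Fin (n + 2) → ℝ) (i : Fin (n + 2)) : ℝ :=
  rootSin Y / ((n : ℝ) + 1) * (cos (Y i) / sin (Y i))

theorem rootSin_pos {n : ℕ} {Y : Fin (n + 2) → ℝ} (hY : ∀ i, 0 < sin (Y i)) : 0 < rootSin Y :=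
  rpow_pos_of_pos (Finset.prod_pos fun i _ => hY i) _

theorem rpow_one_div_pow {n : ℕ} {x : ℝ} (hx : 0 ≤ x) :
    (x ^ (1 / ((n : ℝ) + 1))) ^ (n + 1) = x := by
  have := rpow_inv_natCast_pow hx (Nat.succ_ne_zero n)
  simpa [one_div] using this

theorem pow_rpow_one_div {n : ℕ} {x : ℝ} (hx : 0 ≤ x) :
    (x ^ (n + 1)) ^ (1 / ((n : ℝ) + 1)) = x := by
  have := pow_rpow_inv_natCast hx (Nat.succ_ne_zero n)
  simpa [one_div] using this

/-! ### Derivatives along lines and strict concavity -/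

theorem hasDerivAt_line {n : ℕ} (Y U : Fin (n + 2) → ℝ) (s : ℝ) (i : Fin (n + 2)) :
    HasDerivAt (fun s : ℝ => (Y + s • U) i) (U i) s := by
  simpa using ((hasDerivAt_id s).mul_const (U i)).const_add (Y i)

theorem hasDerivAt_rootSin {n : ℕ} (Y U : Fin (n + 2) → ℝ) (s : ℝ)
    (hY : ∀ i, 0 < sin ((Y + s • U) i)) :
    HasDerivAt (fun s : ℝ => rootSin (Y + s • U)) (∑ i, cotField (Y + s • U) i * U i) s := by
  have hP : 0 < ∏ i, sin ((Y + s • U) i) := Finset.prod_pos fun i _ => hY i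
  have h1 : HasDerivAt (fun s : ℝ => ∏ i, sin ((Y + s • U) i))
      (∑ i, (∏ j ∈ Finset.univ.erase i, sin ((Y + s • U) j)) • (cos ((Y + s • U) i) * U i)) s :=
    HasDerivAt.fun_finsetProd fun i _ => (hasDerivAt_line Y U s i).sin
  have h2 := h1.rpow_const (p := 1 / ((n : ℝ) + 1)) (Or.inl hP.ne')
  refine h2.congr_deriv ?_
  rw [Finset.sum_mul, Finset.sum_mul]
  refine Finset.sum_congr rfl fun i _ => ?_
  rw [← Finset.mul_prod_erase _ _ (Finset.mem_univ i)] at hP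
  rw [rpow_sub_one (by rw [← Finset.mul_prod_erase _ _ (Finset.mem_univ i)]; exact hP.ne'),
    cotField, rootSin]
  have h3 := (pos_of_mul_pos_right hP (hY i).le).ne'
  have h4 := (hY i).ne'
  have h5 : ((n : ℝ) + 1) ≠ 0 := by positivity
  conv_lhs => rw [← Finset.mul_prod_erase Finset.univ (fun j => sin ((Y + s • U) j)) (Finset.mem_univ i)]
  conv_rhs => rw [← Finset.mul_prod_erase Finset.univ (fun j => sin ((Y + s • U) j)) (Finset.mem_univ i)]
  rw [smul_eq_mul]
  field_simp

/-- The second derivative of `rootSin` along a line. The square comes from differentiating the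
factor `rootSin`, the sum of squares from `cot' = -1/sin²`. Its sign is that of a quadratic form in
`U i / sin`. -/
theorem hasDerivAt_sum_cotField {n : ℕ} (Y U : Fin (n + 2) → ℝ) (s : ℝ)
    (hY : ∀ i, 0 < sin ((Y + s • U) i)) :
    HasDerivAt (fun s : ℝ => ∑ i, cotField (Y + s • U) i * U i)
      (rootSin (Y + s • U) / ((n : ℝ) + 1) ^ 2 *
        ((∑ i, cos ((Y + s • U) i) * (U i / sin ((Y + s • U) i))) ^ 2 -
          ((n : ℝ) + 1) * ∑ i, (U i / sin ((Y + s • U) i)) ^ 2)) s := by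
  have h5 : ((n : ℝ) + 1) ≠ 0 := by positivity
  have h1 := hasDerivAt_rootSin Y U s hY
  have h2 : ∀ i, HasDerivAt (fun s : ℝ => cos ((Y + s • U) i) / sin ((Y + s • U) i) * U i)
      (-(U i / sin ((Y + s • U) i)) ^ 2) s := by
    intro i
    have h := (((hasDerivAt_line Y U s i).cos.div (hasDerivAt_line Y U s i).sin (hY i).ne').mul_const
      (U i))
    refine h.congr_deriv ?_
    have h4 := (hY i).ne'
    field_simp
    linear_combination (-(U i) ^ 2) * sin_sq_add_cos_sq ((Y + s • U) i)
  have h3 : HasDerivAt (fun s : ℝ => ∑ i, cos ((Y + s • U) i) / sin ((Y + s • U) i) * U i)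
      (∑ i, -(U i / sin ((Y + s • U) i)) ^ 2) s := HasDerivAt.fun_sum fun i _ => h2 i
  have h4 := (h1.div_const ((n : ℝ) + 1)).mul h3
  have e1 : ∀ Z : Fin (n + 2) → ℝ, ∑ i, cotField Z i * U i =
      rootSin Z / ((n : ℝ) + 1) * ∑ i, cos (Z i) / sin (Z i) * U i := fun Z => by
    rw [Finset.mul_sum]
    exact Finset.sum_congr rfl fun i _ => by rw [cotField]; ring
  have e2 : ∑ i, cos ((Y + s • U) i) / sin ((Y + s • U) i) * U i =
      ∑ i, cos ((Y + s • U) i) * (U i / sin ((Y + s • U) i)) :=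
    Finset.sum_congr rfl fun i _ => by ring
  simp only [e1]
  refine h4.congr_deriv ?_
  rw [e1, e2, Finset.sum_neg_distrib]
  field_simp
  ring

/-- Since `v` is orthogonal to the vector of sines, only the component of the vector of cosines
orthogonal to the sines matters. Its squared length is `n + 2 - A - B²/A`, which is below `n + 1`
exactly when `A < A² + B²`. -/
theorem sq_sum_cos_mul_lt {n : ℕ} {Y v : Fin (n + 2) → ℝ} (hY : ∀ i, 0 < Y i ∧ Y i < π / 2)
    (hv : v ≠ 0) (h0 : ∑ i, sin (Y i) * v i = 0) :
    (∑ i, cos (Y i) * v i) ^ 2 < ((n : ℝ) + 1) * ∑ i, v i ^ 2 := by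
  set A := ∑ i, sin (Y i) ^ 2 with hA
  set B := ∑ i, sin (Y i) * cos (Y i) with hB
  have hs : ∀ i, 0 < sin (Y i) := fun i =>
    sin_pos_of_pos_of_lt_pi (hY i).1 (by linarith [(hY i).2, pi_pos])
  have hA0 : 0 < A := Finset.sum_pos (fun i _ => pow_pos (hs i) 2) Finset.univ_nonempty
  have hC : ∑ i, cos (Y i) ^ 2 = (n : ℝ) + 2 - A := by
    rw [hA, eq_sub_iff_add_eq, ← Finset.sum_add_distrib]
    simp
  have hv0 : 0 < ∑ i, v i ^ 2 := by
    obtain ⟨i, hi⟩ := Function.ne_iff.1 hv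
    exact Finset.sum_pos' (fun i _ => sq_nonneg _) ⟨i, Finset.mem_univ i, by
      have : v i ≠ 0 := hi
      positivity⟩
  -- `A² + B²` is the squared modulus of `∑ sin Y_i · exp(i Y_i)`. Its expansion has diagonal sum
  -- `A` and positive off-diagonal terms, because the angles differ by less than `π/2`.
  have hAB : A < A ^ 2 + B ^ 2 := by
    have e : A ^ 2 + B ^ 2 = ∑ i, ∑ j, sin (Y i) * sin (Y j) * cos (Y i - Y j) := by
      rw [sq, sq, hA, hB, Finset.sum_mul_sum, Finset.sum_mul_sum, ← Finset.sum_add_distrib]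
      refine Finset.sum_congr rfl fun i _ => ?_
      rw [← Finset.sum_add_distrib]
      refine Finset.sum_congr rfl fun j _ => ?_
      rw [cos_sub]
      ring
    rw [e, hA]
    have hpos : ∀ i j, 0 < sin (Y i) * sin (Y j) * cos (Y i - Y j) := fun i j =>
      mul_pos (mul_pos (hs i) (hs j)) (cos_pos_of_mem_Ioo
        ⟨by linarith [(hY i).1, (hY j).2], by linarith [(hY i).2, (hY j).1]⟩)
    refine Finset.sum_lt_sum_of_nonempty Finset.univ_nonempty fun i _ => ?_
    obtain ⟨j, hj⟩ := exists_ne i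
    have := Finset.sum_lt_sum_of_subset (f := fun j => sin (Y i) * sin (Y j) * cos (Y i - Y j))
      (Finset.subset_univ {i}) (Finset.mem_univ j) (by simpa using hj) (hpos i j)
      fun j _ _ => (hpos i j).le
    simpa [sq] using this
  -- Cauchy–Schwarz with `A` times the component of the cosines orthogonal to the sines, which
  -- avoids dividing by `A`.
  have hCS := Finset.sum_mul_sq_le_sq_mul_sq Finset.univ
    (fun i => A * cos (Y i) - B * sin (Y i)) v
  have e1 : ∑ i, (A * cos (Y i) - B * sin (Y i)) * v i = A * ∑ i, cos (Y i) * v i := by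
    rw [Finset.mul_sum, ← sub_eq_zero, ← Finset.sum_sub_distrib]
    rw [← mul_zero (-B), ← h0, Finset.mul_sum]
    exact Finset.sum_congr rfl fun i _ => by ring
  have e2 : ∑ i, (A * cos (Y i) - B * sin (Y i)) ^ 2 = A * (A * ((n : ℝ) + 2 - A) - B ^ 2) := by
    have : ∀ i, (A * cos (Y i) - B * sin (Y i)) ^ 2 =
        A ^ 2 * cos (Y i) ^ 2 - 2 * A * B * (sin (Y i) * cos (Y i)) + B ^ 2 * sin (Y i) ^ 2 :=
      fun i => by ring
    simp only [this, Finset.sum_add_distrib, Finset.sum_sub_distrib, ← Finset.mul_sum, hC]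
    rw [← hA, ← hB]
    ring
  rw [e1, e2] at hCS
  have h1 : A ^ 2 * (∑ i, cos (Y i) * v i) ^ 2 < A ^ 2 * (((n : ℝ) + 1) * ∑ i, v i ^ 2) := by
    have h2 : A * (A * ((n : ℝ) + 2 - A) - B ^ 2) < A ^ 2 * ((n : ℝ) + 1) := by
      have : A * (A * ((n : ℝ) + 2 - A) - B ^ 2) =
          A ^ 2 * ((n : ℝ) + 1) - A * (A ^ 2 + B ^ 2 - A) := by ring
      rw [this]
      linarith [mul_pos hA0 (sub_pos.2 hAB)]
    have h3 := mul_lt_mul_of_pos_right h2 hv0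
    nlinarith
  exact lt_of_mul_lt_mul_left h1 (sq_nonneg A)

theorem sum_cotField_deriv_neg {n : ℕ} {Y U : Fin (n + 2) → ℝ} (hY : ∀ i, 0 < Y i ∧ Y i < π / 2)
    (hU : U ≠ 0) (h0 : ∑ i, U i = 0) :
    rootSin Y / ((n : ℝ) + 1) ^ 2 * ((∑ i, cos (Y i) * (U i / sin (Y i))) ^ 2 -
      ((n : ℝ) + 1) * ∑ i, (U i / sin (Y i)) ^ 2) < 0 := by
  have hs : ∀ i, 0 < sin (Y i) := fun i =>
    sin_pos_of_pos_of_lt_pi (hY i).1 (by linarith [(hY i).2, pi_pos])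
  refine mul_neg_of_pos_of_neg (div_pos (rootSin_pos hs) (by positivity)) (sub_neg.2 ?_)
  refine sq_sum_cos_mul_lt (v := fun i => U i / sin (Y i)) hY ?_ ?_
  · obtain ⟨i, hi⟩ := Function.ne_iff.1 hU
    exact Function.ne_iff.2 ⟨i, div_ne_zero hi (hs i).ne'⟩
  · rw [← h0]
    exact Finset.sum_congr rfl fun i _ => mul_div_cancel₀ _ (hs i).ne'

/-- Strict monotonicity of the gradient of a strictly concave function, from the second derivative
along the segment. Equality of the two sums makes the direction `Y' - Y` have sum zero. -/
theorem sum_cotField_sub_mul_neg {n : ℕ} {Y Y' : Fin (n + 2) → ℝ}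
    (hY : ∀ i, 0 < Y i ∧ Y i < π / 2) (hY' : ∀ i, 0 < Y' i ∧ Y' i < π / 2)
    (hs : ∑ i, Y i = ∑ i, Y' i) (hne : Y ≠ Y') :
    ∑ i, (cotField Y' i - cotField Y i) * (Y' i - Y i) < 0 := by
  have hmem : ∀ s ∈ Icc (0 : ℝ) 1, ∀ i, 0 < (Y + s • (Y' - Y)) i ∧ (Y + s • (Y' - Y)) i < π / 2 := by
    intro s hs i
    have := (convex_Ioo (0 : ℝ) (π / 2)).add_smul_sub_mem (hY i) (hY' i) hs
    exact this
  have hsin : ∀ s ∈ Icc (0 : ℝ) 1, ∀ i, 0 < sin ((Y + s • (Y' - Y)) i) := fun s hs i =>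
    sin_pos_of_pos_of_lt_pi (hmem s hs i).1 (by linarith [(hmem s hs i).2, pi_pos])
  have hder := fun s hs => hasDerivAt_sum_cotField Y (Y' - Y) s (hsin s hs)
  have hanti : StrictAntiOn (fun s : ℝ => ∑ i, cotField (Y + s • (Y' - Y)) i * (Y' - Y) i)
      (Icc 0 1) := by
    refine strictAntiOn_of_deriv_neg (convex_Icc 0 1)
      (fun s hs => (hder s hs).continuousAt.continuousWithinAt) fun s hs' => ?_
    rw [interior_Icc] at hs'
    rw [(hder s (Ioo_subset_Icc_self hs')).deriv]
    refine sum_cotField_deriv_neg (hmem s (Ioo_subset_Icc_self hs')) (sub_ne_zero.2 hne.symm) ?_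
    simp [hs]
  have := hanti (left_mem_Icc.2 zero_le_one) (right_mem_Icc.2 zero_le_one) zero_lt_one
  simp only [zero_smul, add_zero, one_smul, add_sub_cancel] at this
  simp only [sub_mul, Finset.sum_sub_distrib]
  exact sub_neg.2 this

/-! ### The gradient on the simplex -/

/-- The angles `(π/2 - ∑ yⱼ, y_1, …, y_{n+1})`. -/
noncomputable def complete {n : ℕ} (y : Vec n) : Fin (n + 2) → ℝ := Fin.cons (π / 2 - ∑ j, y j) y

/-- The direction `(-∑ uⱼ, u_1, …, u_{n+1})`. -/
def lift {n : ℕ} (u : Vec n) : Fin (n + 2) → ℝ := Fin.cons (-∑ j, u j) u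

/-- The gradient of `y ↦ rootSin (complete y)`. -/
noncomputable def grad {n : ℕ} (y : Vec n) : Vec n :=
  fun j => cotField (complete y) j.succ - cotField (complete y) 0

theorem sum_complete {n : ℕ} (y : Vec n) : ∑ i, complete y i = π / 2 := by
  simp [complete, Fin.sum_univ_succ]

theorem complete_injective {n : ℕ} : Function.Injective (complete (n := n)) := fun y y' h => by
  funext j
  simpa [complete] using congrFun h j.succ

theorem complete_comb {n : ℕ} {b : Fin (n + 2) → ℝ} (hb : ∑ i, b i = 1) :
    complete (comb b) = (π / 2) • b := by
  funext i
  refine Fin.cases ?_ (fun j => ?_) i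
  · rw [Fin.sum_univ_succ] at hb
    simp only [complete, Fin.cons_zero, comb_apply, ← Finset.sum_mul, Pi.smul_apply, smul_eq_mul]
    linear_combination (-(π / 2)) * hb
  · simp [complete, comb_apply, mul_comm]

theorem smul_complete_mem {n : ℕ} {y : Vec n} (hy : ∀ i, 0 < complete y i) :
    (2 / π) • complete y ∈ openBary n := by
  have := pi_pos
  refine ⟨fun i => mul_pos (by positivity) (hy i), ?_⟩
  simp only [Pi.smul_apply, smul_eq_mul, ← Finset.mul_sum, sum_complete]
  field_simp

theorem comb_smul_complete {n : ℕ} (y : Vec n) : comb ((2 / π) • complete y) = y := by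
  have := pi_pos
  funext j
  rw [comb_apply]
  simp only [Pi.smul_apply, smul_eq_mul, complete, Fin.cons_succ]
  field_simp

theorem mem_openSimplex {n : ℕ} {y : Vec n} : y ∈ openSimplex n ↔ ∀ i, 0 < complete y i := by
  constructor
  · rintro ⟨b, hb, rfl⟩ i
    rw [complete_comb hb.2]
    exact mul_pos (by positivity) (hb.1 i)
  · intro hy
    exact ⟨_, smul_complete_mem hy, comb_smul_complete y⟩

theorem complete_lt {n : ℕ} {y : Vec n} (hy : y ∈ openSimplex n) (i : Fin (n + 2)) :
    0 < complete y i ∧ complete y i < π / 2 := by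
  rw [mem_openSimplex] at hy
  refine ⟨hy i, ?_⟩
  obtain ⟨j, hj⟩ := exists_ne i
  rw [← sum_complete y]
  exact Finset.single_lt_sum hj (Finset.mem_univ i) (Finset.mem_univ j) (hy j)
    fun k _ _ => (hy k).le

theorem sin_complete_pos {n : ℕ} {y : Vec n} (hy : y ∈ openSimplex n) (i : Fin (n + 2)) :
    0 < sin (complete y i) :=
  sin_pos_of_pos_of_lt_pi (complete_lt hy i).1 (by linarith [(complete_lt hy i).2, pi_pos])

theorem complete_add_smul {n : ℕ} (y u : Vec n) (s : ℝ) :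
    complete (y + s • u) = complete y + s • lift u := by
  funext i
  refine Fin.cases ?_ (fun j => ?_) i
  · simp [complete, lift, Finset.sum_add_distrib, ← Finset.mul_sum]
    ring
  · simp [complete, lift]

theorem complete_sub_complete {n : ℕ} (y y' : Vec n) :
    complete y' - complete y = lift (y' - y) := by
  have := complete_add_smul y (y' - y) 1
  rw [one_smul, one_smul, add_sub_cancel] at this
  rw [this, add_sub_cancel_left]

theorem sum_lift {n : ℕ} (u : Vec n) : ∑ i, lift u i = 0 := by
  simp [lift, Fin.sum_univ_succ]

theorem lift_ne_zero {n : ℕ} {u : Vec n} (hu : u ≠ 0) : lift u ≠ 0 := by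
  obtain ⟨j, hj⟩ := Function.ne_iff.1 hu
  exact Function.ne_iff.2 ⟨j.succ, by simpa [lift] using hj⟩

/-- Translates between the `n + 2` dependent angles and the `n + 1` free coordinates; this is where
the differences `g j.succ - g 0` in `grad` come from. -/
theorem sum_mul_lift {n : ℕ} (g : Fin (n + 2) → ℝ) (u : Vec n) :
    ∑ i, g i * lift u i = ∑ j, (g j.succ - g 0) * u j := by
  simp only [Fin.sum_univ_succ, lift, Fin.cons_zero, Fin.cons_succ, sub_mul,
    Finset.sum_sub_distrib, ← Finset.mul_sum]
  ring

theorem continuous_complete {n : ℕ} (i : Fin (n + 2)) :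
    Continuous fun y : Vec n => complete y i := by
  refine Fin.cases ?_ (fun j => ?_) i
  · simp only [complete, Fin.cons_zero]
    fun_prop
  · simp only [complete, Fin.cons_succ]
    fun_prop

theorem contDiff_complete {n : ℕ} (i : Fin (n + 2)) :
    ContDiff ℝ ∞ fun y : Vec n => complete y i := by
  refine Fin.cases ?_ (fun j => ?_) i
  · simp only [complete, Fin.cons_zero]
    fun_prop
  · simp only [complete, Fin.cons_succ]
    fun_prop

theorem isOpen_openSimplex (n : ℕ) : IsOpen (openSimplex n) := by
  have : openSimplex n = ⋂ i, {y | 0 < complete y i} := by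
    ext y
    simp [mem_openSimplex]
  rw [this]
  exact isOpen_iInter_of_finite fun i => isOpen_lt continuous_const (continuous_complete i)

theorem contDiffAt_grad {n : ℕ} {y : Vec n} (hy : y ∈ openSimplex n) :
    ContDiffAt ℝ ∞ grad y := by
  have hs := sin_complete_pos hy
  have hroot : ContDiffAt ℝ ∞ (fun y : Vec n => rootSin (complete y)) y := by
    refine ContDiffAt.rpow_const_of_ne ?_ (Finset.prod_pos fun i _ => hs i).ne'
    exact contDiffAt_prod fun i _ => (contDiff_complete i).contDiffAt.sin
  have hcot : ∀ i, ContDiffAt ℝ ∞ (fun y : Vec n => cotField (complete y) i) y := fun i =>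
    (hroot.div_const _).mul
      ((contDiff_complete i).contDiffAt.cos.div (contDiff_complete i).contDiffAt.sin (hs i).ne')
  exact contDiffAt_pi.2 fun j => (hcot _).sub (hcot _)

theorem hasDerivAt_rootSin_complete {n : ℕ} {y : Vec n} (hy : y ∈ openSimplex n) (u : Vec n) :
    HasDerivAt (fun s : ℝ => rootSin (complete (y + s • u))) (∑ j, grad y j * u j) 0 := by
  have := hasDerivAt_rootSin (complete y) (lift u) 0 (by simpa using sin_complete_pos hy)
  simp only [← complete_add_smul, zero_smul, add_zero, sum_mul_lift] at this
  exact this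

/-! ### Injectivity of the gradient and smoothness of its inverse -/

theorem grad_injOn {n : ℕ} : InjOn grad (openSimplex n) := by
  intro y hy y' hy' h
  by_contra hne
  have := sum_cotField_sub_mul_neg (complete_lt hy) (complete_lt hy')
    ((sum_complete y).trans (sum_complete y').symm) (complete_injective.ne hne)
  have e : ∀ i, complete y' i - complete y i = lift (y' - y) i := fun i =>
    congrFun (complete_sub_complete y y') i
  simp only [e] at this
  rw [sum_mul_lift] at this
  refine this.ne (Finset.sum_eq_zero fun j _ => ?_)
  have hj := congrFun h j
  simp only [grad] at hj
  rw [sub_sub_sub_comm, ← hj, sub_self, zero_mul]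

/-- For `u` in the kernel, the derivative of `s ↦ ⟨grad (y + s u), u⟩` at `0` would vanish, whereas
strict concavity makes it negative when `u ≠ 0`. -/
theorem fderiv_grad_injective {n : ℕ} {y : Vec n} (hy : y ∈ openSimplex n) :
    Function.Injective (fderiv ℝ grad y) := by
  refine (injective_iff_map_eq_zero _).2 fun u hu => ?_
  by_contra hne
  have h1 := hasDerivAt_sum_cotField (complete y) (lift u) 0 (by simpa using sin_complete_pos hy)
  have hneg := sum_cotField_deriv_neg (complete_lt hy) (lift_ne_zero hne) (sum_lift u)
  simp only [← complete_add_smul, zero_smul, add_zero, sum_mul_lift] at h1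
  have hd : HasFDerivAt grad (fderiv ℝ grad y) (y + (0 : ℝ) • u) := by
    rw [zero_smul, add_zero]
    exact ((contDiffAt_grad hy).differentiableAt (by simp)).hasFDerivAt
  have hl : HasDerivAt (fun s : ℝ => y + s • u) u 0 := by
    simpa using ((hasDerivAt_id (0 : ℝ)).smul_const u).const_add y
  have h2 := hasDerivAt_pi.1 (hd.comp_hasDerivAt (0 : ℝ) hl)
  have h3 : HasDerivAt (fun s : ℝ => ∑ j, grad (y + s • u) j * u j) 0 0 := by
    have := HasDerivAt.fun_sum (u := Finset.univ) fun j _ => (h2 j).mul_const (u j)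
    simpa [hu] using this
  exact hneg.ne (h1.unique h3)

theorem exists_grad_equiv {n : ℕ} {y : Vec n} (hy : y ∈ openSimplex n) :
    ∃ L : Vec n ≃L[ℝ] Vec n, HasFDerivAt grad (L : Vec n →L[ℝ] Vec n) y := by
  refine ⟨(LinearEquiv.ofInjectiveEndo (fderiv ℝ grad y : Vec n →ₗ[ℝ] Vec n)
    (fderiv_grad_injective hy)).toContinuousLinearEquiv, ?_⟩
  exact ((contDiffAt_grad hy).differentiableAt (by simp)).hasFDerivAt.congr_fderiv rfl

theorem isOpen_image_grad (n : ℕ) : IsOpen (grad '' openSimplex n) := by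
  rw [isOpen_iff_mem_nhds]
  rintro _ ⟨y, hy, rfl⟩
  obtain ⟨L, hL⟩ := exists_grad_equiv hy
  rw [← ((contDiffAt_grad hy).hasStrictFDerivAt' hL (by simp)).map_nhds_eq_of_equiv]
  exact Filter.image_mem_map ((isOpen_openSimplex n).mem_nhds hy)

/-- The inverse of `grad` on the simplex. -/
noncomputable def gradInv {n : ℕ} : Vec n → Vec n := Function.invFunOn grad (openSimplex n)

theorem gradInv_mem {n : ℕ} {x : Vec n} (hx : x ∈ grad '' openSimplex n) :
    gradInv x ∈ openSimplex n := Function.invFunOn_mem hx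

theorem grad_gradInv {n : ℕ} {x : Vec n} (hx : x ∈ grad '' openSimplex n) :
    grad (gradInv x) = x := Function.invFunOn_eq hx

theorem gradInv_grad {n : ℕ} {y : Vec n} (hy : y ∈ openSimplex n) : gradInv (grad y) = y :=
  grad_injOn (gradInv_mem ⟨y, hy, rfl⟩) hy (grad_gradInv ⟨y, hy, rfl⟩)

/-- The local inverse from the inverse function theorem is smooth and, by continuity, takes values
in the simplex near `grad y`; global injectivity there forces it to agree with `gradInv`. -/
theorem contDiffAt_gradInv {n : ℕ} {x : Vec n} (hx : x ∈ grad '' openSimplex n) :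
    ContDiffAt ℝ ∞ gradInv x := by
  obtain ⟨y, hy, rfl⟩ := hx
  obtain ⟨L, hL⟩ := exists_grad_equiv hy
  have hc := contDiffAt_grad hy
  have hinv := hc.to_localInverse hL (by simp)
  refine hinv.congr_of_eventuallyEq ?_
  have hst := hc.hasStrictFDerivAt' hL (by simp)
  have h1 : hc.localInverse hL (by simp) (grad y) = y := hc.localInverse_apply_image hL (by simp)
  have h2 : ∀ᶠ x in nhds (grad y), hc.localInverse hL (by simp) x ∈ openSimplex n :=
    hinv.continuousAt.eventually_mem (by rw [h1]; exact (isOpen_openSimplex n).mem_nhds hy)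
  filter_upwards [h2, hst.eventually_right_inverse] with x h3 h4
  have h5 : grad (hc.localInverse hL (by simp) x) = x := h4
  conv_lhs => rw [← h5]
  exact gradInv_grad h3

/-! ### The image of the simplex -/

/-- The homogeneous coordinates `(0, x_1, …, x_{n+1})`. -/
def homog {n : ℕ} (x : Vec n) : Fin (n + 2) → ℝ := Fin.cons 0 x

/-- The product `∏_{i ≠ k} (xᵢ - x_k)`, where `x_0 = 0`. -/
def gapProd {n : ℕ} (k : Fin (n + 2)) (x : Vec n) : ℝ :=
  ∏ i, (homog x (k.succAbove i) - homog x k)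

/-- The points of the amoeba which satisfy a strict inequality. -/
def strictAmoeba (n : ℕ) : Set (Vec n) :=
  {x | ∀ k, (∀ i, homog x k ≤ homog x i) → gapProd k x < 1 / ((n : ℝ) + 1) ^ (n + 1)}

theorem reflection_reflection {n : ℕ} (k : Fin (n + 1)) (x : Vec n) :
    reflection k (reflection k x) = x := by
  funext j
  by_cases h : j = k <;> simp [reflection, h]

/-- In homogeneous coordinates modulo the diagonal, `R*_k` is the transposition of the indices `0`
and `k`; the subtraction restores the normalization that the zeroth coordinate is `0`. -/
theorem reflection_apply {n : ℕ} (k j : Fin (n + 1)) (x : Vec n) :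
    reflection k x j = homog x (Equiv.swap 0 k.succ j.succ) - homog x k.succ := by
  by_cases h : j = k
  · subst h
    simp [reflection, homog]
  · rw [Equiv.swap_apply_of_ne_of_ne (Fin.succ_ne_zero j) (by simpa using h)]
    simp [reflection, homog, h]

theorem prod_reflection {n : ℕ} (k : Fin (n + 1)) (x : Vec n) :
    ∏ j, reflection k x j = gapProd k.succ x := by
  -- The vanishing factor at `i = k` is replaced by `1`, so that the product runs over all indices
  -- and can be reindexed by the transposition.
  have h1 := Fin.prod_univ_succAbove
    (fun i => if i = k.succ then 1 else homog x i - homog x k.succ) k.succ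
  rw [← Equiv.prod_comp (Equiv.swap 0 k.succ), Fin.prod_univ_succ] at h1
  simp only [Equiv.swap_apply_left, if_true, one_mul, Fin.succAbove_ne, if_false] at h1
  rw [gapProd, ← h1]
  refine Finset.prod_congr rfl fun j _ => ?_
  rw [if_neg, reflection_apply]
  rw [← Equiv.eq_symm_apply]
  simp [Fin.succ_ne_zero]

theorem gapProd_zero {n : ℕ} (x : Vec n) : gapProd 0 x = ∏ j, x j := by
  simp [gapProd, homog]

theorem mem_amoeba_iff_exists {n : ℕ} {x : Vec n} : x ∈ amoeba n ↔
    ∃ k, (∀ i, homog x k ≤ homog x i) ∧ gapProd k x ≤ 1 / ((n : ℝ) + 1) ^ (n + 1) := by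
  rw [Fin.exists_fin_succ]
  refine or_congr ?_ ?_
  · rw [gapProd_zero]
    refine and_congr ?_ Iff.rfl
    exact ⟨fun h i => Fin.cases le_rfl h i, fun h j => h j.succ⟩
  · rw [mem_iUnion]
    refine exists_congr fun k => ?_
    have h1 : x ∈ reflection k '' amoebaZero n ↔ reflection k x ∈ amoebaZero n := by
      constructor
      · rintro ⟨z, hz, rfl⟩
        rwa [reflection_reflection]
      · exact fun h => ⟨_, h, reflection_reflection k x⟩
    rw [h1]
    refine and_congr ?_ (by rw [prod_reflection])
    constructor
    · intro h i
      by_cases hi : i = k.succ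
      · rw [hi]
      · obtain ⟨j, hj⟩ := Fin.exists_succ_eq.2 (show Equiv.swap 0 k.succ i ≠ 0 from
          fun h0 => hi (by simpa using (Equiv.eq_symm_apply _).2 h0))
        have := h j
        rw [reflection_apply, hj, Equiv.swap_apply_self] at this
        linarith
    · intro h j
      rw [reflection_apply]
      exact sub_nonneg.2 (h _)

theorem gapProd_eq_zero {n : ℕ} {x : Vec n} {k i : Fin (n + 2)} (hik : i ≠ k)
    (h : homog x i = homog x k) : gapProd k x = 0 := by
  obtain ⟨j, rfl⟩ := Fin.exists_succAbove_eq hik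
  exact Finset.prod_eq_zero (Finset.mem_univ j) (sub_eq_zero.2 h)

/-- The choice of the minimal index is immaterial: if two indices attain the minimum, the gap
product at each of them is zero. -/
theorem mem_amoeba_iff {n : ℕ} {x : Vec n} : x ∈ amoeba n ↔
    ∀ k, (∀ i, homog x k ≤ homog x i) → gapProd k x ≤ 1 / ((n : ℝ) + 1) ^ (n + 1) := by
  rw [mem_amoeba_iff_exists]
  constructor
  · rintro ⟨k, hk, h⟩ k' hk'
    by_cases hkk : k = k'
    · rwa [← hkk]
    · rw [gapProd_eq_zero hkk (le_antisymm (hk k') (hk' k))]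
      positivity
  · intro h
    obtain ⟨k, hk⟩ := Finite.exists_min (homog x)
    exact ⟨k, hk, h k hk⟩

theorem strictAmoeba_subset {n : ℕ} : strictAmoeba n ⊆ amoeba n := fun _ hx =>
  mem_amoeba_iff.2 fun k hk => (hx k hk).le

theorem homog_smul {n : ℕ} (r : ℝ) (x : Vec n) (i : Fin (n + 2)) :
    homog (r • x) i = r * homog x i := by
  refine Fin.cases ?_ (fun j => ?_) i <;> simp [homog]

theorem gapProd_smul {n : ℕ} (k : Fin (n + 2)) (r : ℝ) (x : Vec n) :
    gapProd k (r • x) = r ^ (n + 1) * gapProd k x := by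
  simp only [gapProd, homog_smul, ← mul_sub, Finset.prod_mul_distrib]
  simp

/-- Dilating by `r > 1` preserves the minimal index and multiplies the gap product by `r ^ (n + 1)`.
A point where the bound is not strict is therefore a limit of points outside the amoeba. -/
theorem interior_amoeba_subset {n : ℕ} : interior (amoeba n) ⊆ strictAmoeba n := by
  intro x hx k hk
  by_contra! h
  have hcont : Filter.Tendsto (fun r : ℝ => r • x) (nhdsWithin 1 (Ioi 1)) (nhds x) := by
    have : ContinuousAt (fun r : ℝ => r • x) 1 := by fun_prop
    have h2 := this.tendsto
    rw [one_smul] at h2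
    exact h2.mono_left nhdsWithin_le_nhds
  obtain ⟨r, hr, hr1⟩ := ((hcont.eventually_mem (mem_interior_iff_mem_nhds.1 hx)).and
    self_mem_nhdsWithin).exists
  have hr1 : 1 < r := hr1
  have h1 := mem_amoeba_iff.1 hr k fun i => by
    rw [homog_smul, homog_smul]
    exact mul_le_mul_of_nonneg_left (hk i) (by linarith)
  rw [gapProd_smul] at h1
  have h2 : 0 < gapProd k x := lt_of_lt_of_le (by positivity) h
  have h3 : 1 < r ^ (n + 1) := one_lt_pow₀ hr1 (by simp)
  nlinarith

/-! ### The gradient maps the simplex onto the strict region -/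

theorem homog_sub_homog {n : ℕ} {x : Vec n} {g : Fin (n + 2) → ℝ}
    (h : ∀ j, x j = g j.succ - g 0) (i k : Fin (n + 2)) : homog x i - homog x k = g i - g k := by
  have : ∀ i, homog x i = g i - g 0 := by
    intro i
    refine Fin.cases ?_ (fun j => ?_) i
    · simp [homog]
    · simp [homog, h j]
  rw [this, this]
  ring

/-- The power `rootSin ^ (n + 1)` is the product of all sines and clears the denominators of the
cotangents. What remains is `(n+1)^{-(n+1)} sin Y_k ∏ (cos Y_i - sin Y_i cot Y_k)`. Each factor of
the product lies in `[0, 1]`, since `cot Y_k` is minimal and nonnegative, and `sin Y_k < 1`. -/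
theorem grad_mem_strictAmoeba {n : ℕ} {y : Vec n} (hy : y ∈ openSimplex n) :
    grad y ∈ strictAmoeba n := by
  intro k hk
  have hs := sin_complete_pos hy
  have hsub := homog_sub_homog (x := grad y) (g := cotField (complete y)) fun j => rfl
  have hpos := rootSin_pos hs
  have hc : ∀ i, cos (complete y k) / sin (complete y k) ≤ cos (complete y i) / sin (complete y i) := by
    intro i
    have h1 := hsub i k
    have h2 := hk i
    have h3 : cotField (complete y) k ≤ cotField (complete y) i := by linarith
    exact le_of_mul_le_mul_left h3 (by positivity)
  have hn : (0 : ℝ) < (n : ℝ) + 1 := by positivity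
  have e : gapProd k (grad y) = 1 / ((n : ℝ) + 1) ^ (n + 1) * (sin (complete y k) *
      ∏ i, (cos (complete y (k.succAbove i)) -
        sin (complete y (k.succAbove i)) * (cos (complete y k) / sin (complete y k)))) := by
    have h1 : ∀ i, homog (grad y) (k.succAbove i) - homog (grad y) k =
        rootSin (complete y) / ((n : ℝ) + 1) * ((sin (complete y (k.succAbove i)))⁻¹ *
          (cos (complete y (k.succAbove i)) -
            sin (complete y (k.succAbove i)) * (cos (complete y k) / sin (complete y k)))) := by
      intro i
      have := (hs (k.succAbove i)).ne'
      rw [hsub, cotField, cotField]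
      field_simp
    rw [gapProd, Finset.prod_congr rfl fun i _ => h1 i, Finset.prod_mul_distrib,
      Finset.prod_const, Finset.card_univ, Fintype.card_fin, Finset.prod_mul_distrib, div_pow,
      rootSin, rpow_one_div_pow (Finset.prod_nonneg fun i _ => (hs i).le),
      Fin.prod_univ_succAbove _ k, Finset.prod_inv_distrib]
    have : ∏ i, sin (complete y (k.succAbove i)) ≠ 0 := Finset.prod_ne_zero_iff.2 fun i _ => (hs _).ne'
    generalize ∏ i, (cos (complete y (k.succAbove i)) -
      sin (complete y (k.succAbove i)) * (cos (complete y k) / sin (complete y k))) = Q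
    field_simp
  rw [e]
  refine mul_lt_of_lt_one_right (by positivity) ?_
  refine mul_lt_one_of_nonneg_of_lt_one_left (hs k).le ?_ (Finset.prod_le_one ?_ ?_)
  · rw [← sin_pi_div_two]
    exact sin_lt_sin_of_lt_of_le_pi_div_two (by linarith [(complete_lt hy k).1, pi_pos]) le_rfl
      (complete_lt hy k).2
  · intro i _
    have := hc (k.succAbove i)
    rw [le_div_iff₀ (hs _)] at this
    linarith
  · intro i _
    have h1 : 0 ≤ cos (complete y k) := (cos_pos_of_mem_Ioo
      ⟨by linarith [(complete_lt hy k).1, pi_pos], (complete_lt hy k).2⟩).le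
    have h2 := cos_le_one (complete y (k.succAbove i))
    have h3 : 0 ≤ sin (complete y (k.succAbove i)) * (cos (complete y k) / sin (complete y k)) :=
      mul_nonneg (hs _).le (div_nonneg h1 (hs _).le)
    linarith

/-- `sin (t a) = t (a sinc (t a))`. -/
theorem sin_mul_eq (t a : ℝ) : sin (t * a) = t * (a * sinc (t * a)) := by
  by_cases h : t * a = 0
  · rw [h]
    simp only [sin_zero, sinc_zero, mul_one, h]
  · rw [sinc_of_ne_zero h]
    have h1 := left_ne_zero_of_mul h
    have h2 := right_ne_zero_of_mul h
    field_simp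

/-- Near the vertex `p_k`, the function exceeds any linear function of the strict region. -/
theorem exists_rootSin_gt {n : ℕ} (k : Fin (n + 2)) {d : Fin (n + 1) → ℝ} (hd : ∀ i, 0 ≤ d i)
    (hp : ∏ i, d i < 1 / ((n : ℝ) + 1) ^ (n + 1)) :
    ∃ Y : Fin (n + 2) → ℝ, (∀ i, 0 < Y i) ∧ ∑ i, Y i = π / 2 ∧
      ∑ i, d i * Y (k.succAbove i) < rootSin Y := by
  have hn : (0 : ℝ) < (n : ℝ) + 1 := by positivity
  obtain ⟨ε, hε, hε0⟩ : ∃ ε : ℝ, ∏ i, (d i + ε) < 1 / ((n : ℝ) + 1) ^ (n + 1) ∧ 0 < ε := by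
    have hc : ContinuousAt (fun ε : ℝ => ∏ i, (d i + ε)) 0 := by fun_prop
    have h1 := hc.eventually_lt (continuousAt_const (y := 1 / ((n : ℝ) + 1) ^ (n + 1)))
      (by simpa using hp)
    exact ((h1.filter_mono nhdsWithin_le_nhds).and (self_mem_nhdsWithin (s := Ioi 0))).exists
  have hpos : ∀ i, 0 < d i + ε := fun i => by linarith [hd i]
  -- The direction of approach to `p_k`, as in the equality case of AM-GM: each `d i * a i` is at
  -- most `1`, while `∏ a i > (n+1)^{n+1}`. The shift `ε` is needed because some `d i` may vanish.
  set a : Fin (n + 1) → ℝ := fun i => (d i + ε)⁻¹ with ha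
  have hapos : ∀ i, 0 < a i := fun i => inv_pos.2 (hpos i)
  have hda : ∑ i, d i * a i ≤ (n : ℝ) + 1 := by
    have : ∀ i ∈ (Finset.univ : Finset (Fin (n + 1))), d i * a i ≤ 1 := fun i _ => by
      rw [ha, ← div_eq_mul_inv, div_le_one (hpos i)]
      linarith
    simpa using Finset.sum_le_sum this
  have hprod : ((n : ℝ) + 1) ^ (n + 1) < ∏ i, a i := by
    rw [ha, Finset.prod_inv_distrib, lt_inv_comm₀ (by positivity) (Finset.prod_pos fun i _ => hpos i)]
    simpa using hε
  -- This function is `t^{-(n+1)}` times the product of the sines. Its value at `t = 0` is `∏ a i`,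
  -- so the strict bound persists for small `t > 0`.
  have hc : ContinuousAt (fun t : ℝ => cos (t * ∑ i, a i) * ∏ i, (a i * sinc (t * a i))) 0 := by
    have := continuous_sinc
    fun_prop
  have h1 := (continuousAt_const (y := ((n : ℝ) + 1) ^ (n + 1))).eventually_lt hc (by simpa using hprod)
  have hc2 : ContinuousAt (fun t : ℝ => t * ∑ i, a i) 0 := by fun_prop
  have h2 := hc2.eventually_lt (continuousAt_const (y := π / 2)) (by simpa using pi_div_two_pos)
  obtain ⟨t, ⟨ht1, ht2⟩, ht0⟩ := (((h1.and h2).filter_mono nhdsWithin_le_nhds).and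
    (self_mem_nhdsWithin (s := Ioi 0))).exists
  have ht0 : 0 < t := ht0
  refine ⟨k.insertNth (π / 2 - t * ∑ i, a i) (fun i => t * a i), ?_, ?_, ?_⟩
  · intro i
    refine Fin.succAboveCases k ?_ (fun i => ?_) i
    · rw [Fin.insertNth_apply_same]
      linarith
    · rw [Fin.insertNth_apply_succAbove]
      exact mul_pos ht0 (hapos i)
  · rw [sum_insertNth, ← Finset.mul_sum]
    ring
  · simp only [Fin.insertNth_apply_succAbove]
    have e1 : ∑ i, d i * (t * a i) = t * ∑ i, d i * a i := by
      rw [Finset.mul_sum]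
      exact Finset.sum_congr rfl fun i _ => by ring
    rw [e1, rootSin, Fin.prod_univ_succAbove _ k]
    simp only [Fin.insertNth_apply_succAbove, Fin.insertNth_apply_same, sin_pi_div_two_sub,
      sin_mul_eq, Finset.prod_mul_distrib, Finset.prod_const, Finset.card_univ, Fintype.card_fin]
    simp only [Finset.prod_mul_distrib] at ht1
    rw [mul_left_comm, mul_rpow (by positivity) (le_trans (by positivity) ht1.le),
      pow_rpow_one_div ht0.le]
    refine mul_lt_mul_of_pos_left (hda.trans_lt ?_) ht0
    conv_lhs => rw [← pow_rpow_one_div (n := n) hn.le]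
    exact rpow_lt_rpow (by positivity) ht1 (by positivity)

theorem image_grad (n : ℕ) : grad '' openSimplex n = strictAmoeba n := by
  refine Subset.antisymm (by rintro _ ⟨y, hy, rfl⟩; exact grad_mem_strictAmoeba hy) fun x hx => ?_
  obtain ⟨k, hk⟩ := Finite.exists_min (homog x)
  have hd : ∀ i, 0 ≤ homog x (k.succAbove i) - homog x k := fun i => sub_nonneg.2 (hk _)
  -- Since the angles sum to `π/2`, the linear form can be rewritten with the nonnegative
  -- coefficients `x_i - x_k`, up to a constant.
  have hlin : ∀ y : Vec n, ∑ j, x j * y j =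
      ∑ i, (homog x (k.succAbove i) - homog x k) * complete y (k.succAbove i) +
        homog x k * (π / 2) := by
    intro y
    rw [← sum_complete y, Finset.mul_sum, Fin.sum_univ_succAbove _ k, add_left_comm,
      ← Finset.sum_add_distrib]
    have h1 : ∑ j, x j * y j = ∑ i, homog x i * complete y i := by
      simp [Fin.sum_univ_succ, homog, complete]
    rw [h1, Fin.sum_univ_succAbove _ k]
    exact congrArg _ (Finset.sum_congr rfl fun i _ => by ring)
  let K : Set (Vec n) := {y | ∀ i, 0 ≤ complete y i}
  have hKsub : K ⊆ Icc 0 (fun _ => π / 2) := by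
    intro y hy
    have hy' : ∀ j, 0 ≤ y j := fun j => by simpa [complete] using hy j.succ
    refine ⟨hy', fun j => ?_⟩
    have h0 : 0 ≤ π / 2 - ∑ j, y j := hy 0
    have := Finset.single_le_sum (f := y) (fun i _ => hy' i) (Finset.mem_univ j)
    linarith
  have hKc : IsClosed K := by
    have : K = ⋂ i, {y | 0 ≤ complete y i} := by
      ext y
      simp [K]
    rw [this]
    exact isClosed_iInter fun i => isClosed_le continuous_const (continuous_complete i)
  have hK : IsCompact K := isCompact_Icc.of_isClosed_subset hKc hKsub
  obtain ⟨Y₀, hY₀, hsum₀, hgt₀⟩ := exists_rootSin_gt k hd (hx k hk)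
  have hY₀' : complete (fun j => Y₀ j.succ) = Y₀ := by
    funext i
    refine Fin.cases ?_ (fun j => ?_) i
    · rw [Fin.sum_univ_succ] at hsum₀
      simp only [complete, Fin.cons_zero]
      linarith
    · simp [complete]
  have hy₀K : (fun j => Y₀ j.succ) ∈ K := fun i => by
    rw [hY₀']
    exact (hY₀ i).le
  have hcont : Continuous fun y : Vec n => rootSin (complete y) - ∑ j, x j * y j := by
    have h1 : Continuous fun y : Vec n => ∏ i, sin (complete y i) :=
      continuous_finsetProd _ fun i _ => continuous_sin.comp (continuous_complete i)
    have h2 : Continuous fun y : Vec n => rootSin (complete y) :=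
      h1.rpow_const fun y => Or.inr (by positivity)
    fun_prop
  obtain ⟨y, hyK, hmax⟩ := hK.exists_isMaxOn ⟨_, hy₀K⟩ hcont.continuousOn
  have hy : y ∈ openSimplex n := by
    rw [mem_openSimplex]
    -- On a boundary face the root vanishes, so the objective there is at most `-x_k π/2`; the point
    -- `Y₀` near `p_k` does strictly better.
    by_contra! hcon
    obtain ⟨i, hi⟩ := hcon
    have hi0 : complete y i = 0 := le_antisymm hi (hyK i)
    have hroot : rootSin (complete y) = 0 := by
      rw [rootSin, Finset.prod_eq_zero (Finset.mem_univ i) (by rw [hi0, sin_zero])]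
      exact zero_rpow (by positivity)
    have h1 := isMaxOn_iff.1 hmax _ hy₀K
    simp only [hlin, hY₀', hroot] at h1
    have h2 : 0 ≤ ∑ i, (homog x (k.succAbove i) - homog x k) * complete y (k.succAbove i) :=
      Finset.sum_nonneg fun i _ => mul_nonneg (hd i) (hyK _)
    linarith
  refine ⟨y, hy, ?_⟩
  have hloc : IsLocalMax (fun y : Vec n => rootSin (complete y) - ∑ j, x j * y j) y :=
    hmax.isLocalMax (Filter.mem_of_superset ((isOpen_openSimplex n).mem_nhds hy)
      fun z hz i => (mem_openSimplex.1 hz i).le)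
  funext j
  have hline : ContinuousAt (fun s : ℝ => y + s • (Pi.single j 1 : Vec n)) 0 := by fun_prop
  have hl2 : IsLocalMax (fun s : ℝ => rootSin (complete (y + s • (Pi.single j 1 : Vec n))) -
      ∑ i, x i * (y + s • (Pi.single j 1 : Vec n)) i) 0 := by
    have h0 : y + (0 : ℝ) • (Pi.single j 1 : Vec n) = y := by simp
    have := hline.tendsto.eventually (h0.symm ▸ hloc)
    simpa [IsLocalMax, IsMaxFilter] using this
  have hd1 := hasDerivAt_rootSin_complete hy (Pi.single j 1)
  have hd2 : HasDerivAt (fun s : ℝ => ∑ i, x i * (y + s • (Pi.single j 1 : Vec n)) i)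
      (∑ i, x i * (Pi.single j 1 : Vec n) i) 0 := by
    refine HasDerivAt.fun_sum fun i _ => HasDerivAt.const_mul _ ?_
    simpa using ((hasDerivAt_id (0 : ℝ)).mul_const ((Pi.single j 1 : Vec n) i)).const_add (y i)
  have h0 := hl2.hasDerivAt_eq_zero (hd1.sub hd2)
  simpa [Pi.single_apply, sub_eq_zero] using h0

theorem interior_amoeba (n : ℕ) : interior (amoeba n) = strictAmoeba n := by
  refine Subset.antisymm interior_amoeba_subset (interior_maximal strictAmoeba_subset ?_)
  rw [← image_grad]
  exact isOpen_image_grad n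

/-! ### The gradient in the charts of the blow-up -/

/-- At `0`, `sinc` is the divided slope of `sin`, hence analytic; elsewhere it is a quotient of
smooth functions. -/
theorem contDiff_sinc : ContDiff ℝ ∞ sinc := by
  refine contDiff_iff_contDiffAt.2 fun x => ?_
  by_cases hx : x = 0
  · subst hx
    obtain ⟨p, hp⟩ : AnalyticAt ℝ sin 0 := analyticAt_sin
    rw [sinc_eq_dslope]
    exact hp.has_fpower_series_dslope_fslope.analyticAt.contDiffAt
  · refine (contDiff_sin.contDiffAt.div contDiffAt_id hx).congr_of_eventuallyEq ?_
    filter_upwards [isOpen_ne.mem_nhds hx] with y hy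
    exact sinc_of_ne_zero hy

theorem sinc_pos {x : ℝ} (hx : |x| < π) : 0 < sinc x := by
  rcases eq_or_ne x 0 with rfl | h
  · simp
  · have h1 : sinc x = sinc |x| := by
      rcases abs_choice x with h | h <;> rw [h]
      exact (sinc_neg x).symm
    rw [h1, sinc_of_ne_zero (abs_ne_zero.2 h)]
    exact div_pos (sin_pos_of_pos_of_lt_pi (abs_pos.2 h) hx) (abs_pos.2 h)

/-- `cos (t ∑ wᵢ) ∏ wᵢ sinc (t wᵢ)`, that is, `t^{-(n+1)}` times the product of the sines. -/
noncomputable def edgeProd {n : ℕ} (t : ℝ) (w : Fin (n + 1) → ℝ) : ℝ :=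
  cos (t * ∑ i, w i) * ∏ i, (w i * sinc (t * w i))

/-- The field `cotField` at the angles `t wᵢ` and `π/2 - t ∑ wᵢ`, written so as to be smooth
at `t = 0`. -/
noncomputable def edgeField {n : ℕ} (k : Fin (n + 2)) (t : ℝ) (w : Fin (n + 1) → ℝ) :
    Fin (n + 2) → ℝ :=
  k.insertNth (edgeProd t w ^ (1 / ((n : ℝ) + 1)) / ((n : ℝ) + 1) *
      (t * sin (t * ∑ i, w i) / cos (t * ∑ i, w i)))
    (fun i => edgeProd t w ^ (1 / ((n : ℝ) + 1)) / ((n : ℝ) + 1) *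
      (cos (t * w i) / (w i * sinc (t * w i))))

/-- Evenness in `t` is what lets a single formula serve both `C⁺` (`t > 0`) and `C⁻` (`t < 0`). -/
theorem edgeField_abs {n : ℕ} (k : Fin (n + 2)) (t : ℝ) (w : Fin (n + 1) → ℝ) :
    edgeField k |t| w = edgeField k t w := by
  rcases abs_choice t with h | h <;> rw [h]
  simp [edgeField, edgeProd]

/-- `rootSin` equals `t` times the root of `edgeProd`, and this `t` cancels the one in the
denominator of `cot (t w i)`. -/
theorem edgeField_eq_cotField {n : ℕ} (k : Fin (n + 2)) {t : ℝ} (ht : 0 < t)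
    {w : Fin (n + 1) → ℝ} (hP : 0 < edgeProd t w) :
    edgeField k t w = cotField (k.insertNth (π / 2 - t * ∑ i, w i) (fun i => t * w i)) := by
  have hroot : rootSin (k.insertNth (π / 2 - t * ∑ i, w i) (fun i => t * w i) : Fin (n + 2) → ℝ) =
      t * edgeProd t w ^ (1 / ((n : ℝ) + 1)) := by
    have : ∏ i, sin ((k.insertNth (π / 2 - t * ∑ i, w i) (fun i => t * w i) :
        Fin (n + 2) → ℝ) i) = t ^ (n + 1) * edgeProd t w := by
      rw [Fin.prod_univ_succAbove _ k]
      simp only [Fin.insertNth_apply_succAbove, Fin.insertNth_apply_same, sin_pi_div_two_sub,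
        sin_mul_eq, Finset.prod_mul_distrib, Finset.prod_const, Finset.card_univ,
        Fintype.card_fin, edgeProd]
      ring
    rw [rootSin, this, mul_rpow (by positivity) hP.le, pow_rpow_one_div ht.le]
  funext i
  rw [cotField, hroot]
  refine Fin.succAboveCases k ?_ (fun i => ?_) i
  · simp only [edgeField, Fin.insertNth_apply_same, cos_pi_div_two_sub, sin_pi_div_two_sub]
    ring
  · simp only [edgeField, Fin.insertNth_apply_succAbove]
    rw [sin_mul_eq t (w i)]
    have := ht.ne'
    field_simp

/-- The coordinates of the gradient in the chart around the fibre over `p_k`. -/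
noncomputable def chartGrad {n : ℕ} (k : Fin (n + 2)) (c : Vec n) : Vec n := fun j =>
  edgeField k (c (Fin.last n)) (fun i => π / 2 * slope c i) j.succ -
    edgeField k (c (Fin.last n)) (fun i => π / 2 * slope c i) 0

theorem abs_mul_edge_lt {n : ℕ} {c : Vec n} (hc : c ∈ coordDomain n) :
    |c (Fin.last n) * ∑ i, π / 2 * slope c i| < π / 2 := by
  have h1 := slope_sum_pos hc
  have h2 := hc.2
  have h3 := pi_pos
  rw [← Finset.mul_sum, abs_mul, abs_of_pos (by positivity : 0 < π / 2 * ∑ i, slope c i)]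
  nlinarith

theorem sinc_edge_pos {n : ℕ} {c : Vec n} (hc : c ∈ coordDomain n) (i : Fin (n + 1)) :
    0 < sinc (c (Fin.last n) * (π / 2 * slope c i)) := by
  refine sinc_pos ?_
  have h1 := abs_mul_edge_lt hc
  have h2 : ∀ i, 0 < π / 2 * slope c i := fun i => mul_pos pi_div_two_pos (slope_pos hc i)
  have h3 := Finset.single_le_sum (f := fun i => π / 2 * slope c i) (fun i _ => (h2 i).le)
    (Finset.mem_univ i)
  rw [abs_mul, abs_of_pos (Finset.sum_pos (fun i _ => h2 i) Finset.univ_nonempty)] at h1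
  rw [abs_mul, abs_of_pos (h2 i)]
  have := mul_le_mul_of_nonneg_left h3 (abs_nonneg (c (Fin.last n)))
  linarith [pi_pos]

theorem cos_edge_pos {n : ℕ} {c : Vec n} (hc : c ∈ coordDomain n) :
    0 < cos (c (Fin.last n) * ∑ i, π / 2 * slope c i) :=
  cos_pos_of_mem_Ioo (abs_lt.1 (abs_mul_edge_lt hc))

theorem edgeProd_pos {n : ℕ} {c : Vec n} (hc : c ∈ coordDomain n) :
    0 < edgeProd (c (Fin.last n)) (fun i => π / 2 * slope c i) :=
  mul_pos (cos_edge_pos hc) (Finset.prod_pos fun i _ =>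
    mul_pos (mul_pos pi_div_two_pos (slope_pos hc i)) (sinc_edge_pos hc i))

theorem contDiffAt_chartGrad {n : ℕ} (k : Fin (n + 2)) {c : Vec n} (hc : c ∈ coordDomain n) :
    ContDiffAt ℝ ∞ (chartGrad k) c := by
  have ht : ContDiffAt ℝ ∞ (fun c : Vec n => c (Fin.last n)) c :=
    (contDiff_apply ℝ ℝ (Fin.last n)).contDiffAt
  have hw : ∀ i, ContDiffAt ℝ ∞ (fun c : Vec n => π / 2 * slope c i) c := fun i =>
    contDiffAt_const.mul (contDiff_slope i).contDiffAt
  have hW : ContDiffAt ℝ ∞ (fun c : Vec n => c (Fin.last n) * ∑ i, π / 2 * slope c i) c :=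
    ht.mul (ContDiffAt.sum fun i _ => hw i)
  have hs : ∀ i, ContDiffAt ℝ ∞ (fun c : Vec n =>
      π / 2 * slope c i * sinc (c (Fin.last n) * (π / 2 * slope c i))) c := fun i =>
    (hw i).mul (contDiff_sinc.contDiffAt.comp c (ht.mul (hw i)))
  have hR : ContDiffAt ℝ ∞ (fun c : Vec n =>
      edgeProd (c (Fin.last n)) (fun i => π / 2 * slope c i) ^ (1 / ((n : ℝ) + 1)) /
        ((n : ℝ) + 1)) c :=
    ((hW.cos.mul (contDiffAt_prod fun i _ => hs i)).rpow_const_of_ne (edgeProd_pos hc).ne').div_const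
      _
  have hf : ∀ i, ContDiffAt ℝ ∞ (fun c : Vec n =>
      edgeField k (c (Fin.last n)) (fun i => π / 2 * slope c i) i) c := by
    intro i
    refine Fin.succAboveCases k ?_ (fun i => ?_) i
    · simp only [edgeField, Fin.insertNth_apply_same]
      exact hR.mul ((ht.mul hW.sin).div hW.cos (cos_edge_pos hc).ne')
    · simp only [edgeField, Fin.insertNth_apply_succAbove]
      exact hR.mul ((ht.mul (hw i)).cos.div (hs i)
        (mul_pos (mul_pos pi_div_two_pos (slope_pos hc i)) (sinc_edge_pos hc i)).ne')
  exact contDiffAt_pi.2 fun j => (hf _).sub (hf _)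

/-- The absolute value appears because for `t < 0` the chart point is the class of `-(p_k + |t| v)`,
where the gradient is the same as at `p_k + |t| v`. -/
theorem chartGrad_of_ne {n : ℕ} (k : Fin (n + 2)) {c : Vec n} (hc : c ∈ coordDomain n)
    (ht : c (Fin.last n) ≠ 0) : chartGrad k c = grad (comb (bary k |c (Fin.last n)| c)) := by
  have hP := edgeProd_pos hc
  have hP' : 0 < edgeProd |c (Fin.last n)| (fun i => π / 2 * slope c i) := by
    rcases abs_choice (c (Fin.last n)) with h | h <;> rw [h]
    · exact hP
    · simpa [edgeProd] using hP
  have hY : (k.insertNth (π / 2 - |c (Fin.last n)| * ∑ i, π / 2 * slope c i)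
      (fun i => |c (Fin.last n)| * (π / 2 * slope c i)) : Fin (n + 2) → ℝ) =
      complete (comb (bary k |c (Fin.last n)| c)) := by
    rw [complete_comb (bary_mem k (abs_pos.2 ht) hc hc.2).2]
    funext i
    refine Fin.succAboveCases k ?_ (fun i => ?_) i
    · simp only [bary, Fin.insertNth_apply_same, Pi.smul_apply, smul_eq_mul, ← Finset.mul_sum]
      ring
    · simp only [bary, Fin.insertNth_apply_succAbove, Pi.smul_apply, smul_eq_mul]
      ring
  have := edgeField_eq_cotField k (abs_pos.2 ht) hP'
  rw [edgeField_abs, hY] at this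
  funext j
  simp only [chartGrad, grad, this]

theorem edgeField_zero {n : ℕ} (k : Fin (n + 2)) (w : Fin (n + 1) → ℝ) :
    edgeField k 0 w = k.insertNth (α := fun _ => ℝ) 0
      (fun i => (∏ i, w i) ^ (1 / ((n : ℝ) + 1)) / ((n : ℝ) + 1) * (1 / w i)) := by
  simp [edgeField, edgeProd]

/-- At `t = 0` the gaps are `(∏ w)^{1/(n+1)} / ((n+1) w i)`: they are positive, so `k` is the
minimal index, and the `w i` cancel in their product, leaving the extremal value. -/
theorem chartGrad_mem_amoeba {n : ℕ} (k : Fin (n + 2)) {c : Vec n} (hc : c ∈ coordDomain n)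
    (ht : c (Fin.last n) = 0) : chartGrad k c ∈ amoeba n := by
  have hsub := homog_sub_homog (x := chartGrad k c) fun j => rfl
  rw [ht, edgeField_zero] at hsub
  have hw : ∀ i, 0 < π / 2 * slope c i := fun i => mul_pos pi_div_two_pos (slope_pos hc i)
  have hW := Finset.prod_pos fun i (_ : i ∈ Finset.univ) => hw i
  refine mem_amoeba_iff_exists.2 ⟨k, fun i => sub_nonneg.1 ?_, le_of_eq ?_⟩
  · rw [hsub]
    refine Fin.succAboveCases k ?_ (fun i => ?_) i
    · simp
    · have := hw i
      simp only [Fin.insertNth_apply_same, Fin.insertNth_apply_succAbove, sub_zero]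
      positivity
  · simp only [gapProd, hsub, Fin.insertNth_apply_same, Fin.insertNth_apply_succAbove, sub_zero]
    rw [Finset.prod_mul_distrib, Finset.prod_const, Finset.card_univ, Fintype.card_fin, div_pow,
      rpow_one_div_pow hW.le, Finset.prod_div_distrib, Finset.prod_const_one]
    have := hW.ne'
    generalize (∏ i, π / 2 * slope c i) = Q at *
    field_simp

theorem exists_chartGrad_eq {n : ℕ} {x : Vec n} (hx : x ∈ amoeba n) (hx' : x ∉ strictAmoeba n) :
    ∃ k, ∃ c ∈ coordDomain n, c (Fin.last n) = 0 ∧ chartGrad k c = x := by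
  have hn : (0 : ℝ) < (n : ℝ) + 1 := by positivity
  have : ∃ k, (∀ i, homog x k ≤ homog x i) ∧ 1 / ((n : ℝ) + 1) ^ (n + 1) ≤ gapProd k x := by
    simpa [strictAmoeba] using hx'
  obtain ⟨k, hk, hle⟩ := this
  have heq := le_antisymm (mem_amoeba_iff.1 hx k hk) hle
  set d : Fin (n + 1) → ℝ := fun i => homog x (k.succAbove i) - homog x k with hd
  have hdprod : ∏ i, d i = 1 / ((n : ℝ) + 1) ^ (n + 1) := heq
  have hd0 : ∀ i, 0 < d i := by
    intro i
    refine lt_of_le_of_ne (sub_nonneg.2 (hk _)) fun h => ?_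
    rw [Finset.prod_eq_zero (Finset.mem_univ i) h.symm] at hdprod
    exact (by positivity : (0 : ℝ) < 1 / ((n : ℝ) + 1) ^ (n + 1)).ne hdprod
  -- The gaps are proportional to the inverses of the slopes, so the slopes must be proportional to
  -- `1 / d i`; the factor `d (Fin.last n)` makes the last slope equal to `1`.
  let c : Vec n := Fin.snoc (fun i : Fin n => d (Fin.last n) / d i.castSucc) 0
  have hslope : ∀ i, slope c i = d (Fin.last n) / d i := by
    intro i
    refine Fin.lastCases ?_ (fun i => ?_) i
    · simp [slope, div_self (hd0 _).ne']
    · simp [slope, c]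
  have hc0 : c (Fin.last n) = 0 := by simp [c]
  refine ⟨k, c, ⟨fun i => ?_, by simp [hc0]⟩, hc0, ?_⟩
  · simpa [c] using div_pos (hd0 _) (hd0 _)
  have hroot : (∏ i, π / 2 * slope c i) ^ (1 / ((n : ℝ) + 1)) =
      π / 2 * d (Fin.last n) * ((n : ℝ) + 1) := by
    have h0 : 0 ≤ π / 2 * d (Fin.last n) * ((n : ℝ) + 1) :=
      mul_nonneg (mul_nonneg pi_div_two_pos.le (hd0 _).le) hn.le
    rw [← pow_rpow_one_div h0]
    congr 1
    simp only [hslope]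
    rw [Finset.prod_mul_distrib, Finset.prod_div_distrib (f := fun _ => d (Fin.last n)), hdprod]
    simp only [Finset.prod_const, Finset.card_univ, Fintype.card_fin]
    rw [mul_pow, mul_pow]
    field_simp
  have hfield : edgeField k (c (Fin.last n)) (fun i => π / 2 * slope c i) =
      fun i => homog x i - homog x k := by
    rw [hc0, edgeField_zero]
    funext i
    refine Fin.succAboveCases k ?_ (fun i => ?_) i
    · simp
    · simp only [Fin.insertNth_apply_succAbove, hroot]
      rw [hslope]
      change _ = d i
      have h1 := (hd0 i).ne'
      have h2 := (hd0 (Fin.last n)).ne'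
      have h3 := pi_pos.ne'
      field_simp
  funext j
  rw [chartGrad, hfield]
  simp [homog]

/-! ### The function `F` and its differential on the coamoeba -/

theorem signedPoint_neg_notMem {n : ℕ} {b : Fin (n + 2) → ℝ} (hb : b ∈ openBary n) :
    signedPoint (-1) b ∉ coamoebaPos n := by
  rintro ⟨y, ⟨k, rfl⟩ | ⟨b', hb', rfl⟩, hy⟩
  · exact signedPoint_not_vertex (by decide) hb ⟨k, hy⟩
  · have := (signedPoint_inj (σ := 1) (σ' := -1) (by decide) (by decide) hb' hb
      (by rw [← hy]; simp [signedPoint])).1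
    exact absurd this (by decide)

theorem toTorus_neg_notMem {n : ℕ} {y : Vec n} (hy : y ∈ openSimplex n) :
    toTorus (-y) ∉ coamoebaPos n := by
  obtain ⟨b, hb, rfl⟩ := hy
  simpa [signedPoint] using signedPoint_neg_notMem hb

theorem cosSin_eq_prod {n : ℕ} (y : Vec n) : cosSin y = ∏ i, sin (complete y i) := by
  simp [cosSin, Fin.prod_univ_succ, complete, sin_pi_div_two_sub]

theorem cosSin_neg {n : ℕ} (y : Vec n) : cosSin (-y) = (-1) ^ (n + 1) * cosSin y := by
  have : ∏ j, sin ((-y) j) = (-1) ^ (n + 1) * ∏ j, sin (y j) := by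
    simp [Finset.prod_neg]
  rw [cosSin, this]
  simp only [Pi.neg_apply, Finset.sum_neg_distrib, cos_neg, cosSin]
  ring

theorem F_toTorus {n : ℕ} {σ : SignType} (hσ : σ ≠ 0) {y : Vec n} (hy : y ∈ openSimplex n) :
    F (toTorus ((σ : ℝ) • y)) = σ * rootSin (complete y) := by
  have hpos : 0 < cosSin y := by
    rw [cosSin_eq_prod]
    exact Finset.prod_pos fun i _ => sin_complete_pos hy i
  have hroot : |cosSin y| ^ (1 / ((n + 1 : ℕ) : ℝ)) = rootSin (complete y) := by
    rw [abs_of_pos hpos, cosSin_eq_prod, rootSin]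
    push_cast
    rfl
  have hval : ∀ z : Vec n, torusCosSin (toTorus z) = cosSin z := fun _ => rfl
  cases σ
  · exact absurd rfl hσ
  · have h1 : toTorus (-y) ∈ coamoebaNeg n := ⟨toTorus y, ⟨y, Or.inr hy, rfl⟩, rfl⟩
    simp only [SignType.neg_eq_neg_one, SignType.coe_neg, SignType.coe_one, neg_smul, one_smul]
    rw [F, if_neg (toTorus_neg_notMem hy), if_pos h1, hval, cosSin_neg, realRoot, abs_mul,
      abs_pow, abs_neg, abs_one, one_pow, one_mul, hroot]
    -- For even `n` the sign comes from the odd root of a negative number, for odd `n` from the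
    -- prefactor `(-1) ^ n`.
    rcases Nat.even_or_odd n with h | h
    · rw [h.neg_one_pow, pow_succ, h.neg_one_pow, sign_neg (by linarith)]
      simp
    · rw [h.neg_one_pow, pow_succ, h.neg_one_pow, sign_pos (by linarith)]
      simp
  · have h1 : toTorus y ∈ coamoebaPos n := ⟨y, Or.inr hy, rfl⟩
    simp only [SignType.pos_eq_one, SignType.coe_one, one_smul]
    rw [F, if_pos h1, hval, realRoot, hroot, sign_pos hpos]
    simp

/-- Two signs cancel: `F` changes sign under `y ↦ -y`, and so does the direction of differentiation.
-/
theorem dF_toTorus {n : ℕ} {σ : SignType} (hσ : σ ≠ 0) {y : Vec n} (hy : y ∈ openSimplex n) :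
    dF (toTorus ((σ : ℝ) • y)) = grad y := by
  have hσ2 : (σ : ℝ) * σ = 1 := by cases σ <;> simp at hσ ⊢
  funext j
  have h1 : ∀ s : ℝ, toTorus ((σ : ℝ) • y) + toTorus (Pi.single j s) =
      toTorus ((σ : ℝ) • (y + (σ * s) • (Pi.single j 1 : Vec n))) := by
    intro s
    have : (σ : ℝ) • (y + (σ * s) • (Pi.single j 1 : Vec n)) = (σ : ℝ) • y + Pi.single j s := by
      rw [smul_add, smul_smul, ← mul_assoc, hσ2, one_mul, ← Pi.single_smul, smul_eq_mul, mul_one]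
    rw [this]
    rfl
  have hd := hasDerivAt_rootSin_complete hy (Pi.single j 1)
  have hd2 : HasDerivAt (fun s : ℝ => (σ : ℝ) *
      rootSin (complete (y + (σ * s) • (Pi.single j 1 : Vec n)))) (grad y j) 0 := by
    have hlin : HasDerivAt (fun s : ℝ => (σ : ℝ) * s) σ 0 := by
      simpa using (hasDerivAt_id (0 : ℝ)).const_mul (σ : ℝ)
    rw [← mul_zero (σ : ℝ)] at hd
    have h2 := (hd.comp (0 : ℝ) hlin).const_mul (σ : ℝ)
    refine h2.congr_deriv ?_
    rw [mul_left_comm, hσ2]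
    simp [Pi.single_apply]
  refine (hd2.congr_of_eventuallyEq ?_).deriv
  have hc : ContinuousAt (fun s : ℝ => y + (σ * s) • (Pi.single j 1 : Vec n)) 0 := by fun_prop
  filter_upwards [hc.eventually_mem ((isOpen_openSimplex n).mem_nhds (by simpa using hy))] with s hs
  rw [h1, F_toTorus hσ hs]

theorem dF_signedPoint {n : ℕ} {σ : SignType} (hσ : σ ≠ 0) {b : Fin (n + 2) → ℝ}
    (hb : b ∈ openBary n) : dF (signedPoint σ b) = grad (comb b) := dF_toTorus hσ ⟨b, hb, rfl⟩

/-! ### The smooth extension to the blow-up -/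

/-- The `k`-th chart of `C̃` as a homeomorphism between open sets. -/
noncomputable def chartHomeo {n : ℕ} (k : Fin (n + 2)) :
    OpenPartialHomeomorph (BlownUpCoamoeba n) (Vec n) :=
  (blowUpCore n).openPartialHomeomorph (chart k) ⟨k, rfl⟩

theorem chartHomeo_mem_maximalAtlas {n : ℕ} (k : Fin (n + 2)) :
    chartHomeo k ∈ IsManifold.maximalAtlas 𝓘(ℝ, Vec n) ∞ (BlownUpCoamoeba n) := by
  refine IsManifold.subset_maximalAtlas ?_
  exact mem_iUnion.2 ⟨chart k, mem_iUnion.2 ⟨⟨k, rfl⟩, rfl⟩⟩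

theorem contMDiffOn_chartHomeo {n : ℕ} (k : Fin (n + 2)) :
    ContMDiffOn 𝓘(ℝ, Vec n) 𝓘(ℝ, Vec n) ∞ (chartHomeo k) (param k '' coordDomain n) :=
  contMDiffOn_of_mem_maximalAtlas (chartHomeo_mem_maximalAtlas k)

theorem contMDiffOn_param {n : ℕ} (k : Fin (n + 2)) :
    ContMDiffOn 𝓘(ℝ, Vec n) 𝓘(ℝ, Vec n) ∞ (param k) (coordDomain n) :=
  contMDiffOn_symm_of_mem_maximalAtlas (chartHomeo_mem_maximalAtlas k)

theorem exists_param_eq {n : ℕ} (z : BlownUpCoamoeba n) :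
    ∃ k, ∃ c ∈ coordDomain n, param k c = z := by
  rcases z with ⟨q, hq⟩ | ⟨k, l, hl⟩
  · exact ⟨0, mem_chart_source_base 0 hq⟩
  · exact ⟨k, mem_chart_source_exc k hl⟩

theorem exists_param_eq_exc {n : ℕ} {k : Fin (n + 2)} {l : Submodule ℝ (Vec n)}
    (hl : ∃ y ∈ openSimplex n, l = Submodule.span ℝ {y - vertex k}) :
    ∃ c ∈ coordDomain n, c (Fin.last n) = 0 ∧ param k c = .exc k l hl := by
  obtain ⟨c, hc, h⟩ := mem_chart_source_exc k hl
  refine ⟨c, hc, ?_, h⟩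
  by_contra ht
  rw [param_of_ne k hc ht] at h
  cases h

/-- The smooth extension of `(F_{y_1}, …, F_{y_{n+1}})` to `C̃`. -/
noncomputable def blowUpGrad {n : ℕ} : BlownUpCoamoeba n → Vec n
  | .base q _ => dF q
  | .exc k l hl => chartGrad k (chart k (.exc k l hl))

theorem blowUpGrad_param {n : ℕ} (k : Fin (n + 2)) {c : Vec n} (hc : c ∈ coordDomain n) :
    blowUpGrad (param k c) = chartGrad k c := by
  by_cases ht : c (Fin.last n) = 0
  · have h : param k c = .exc k (Submodule.span ℝ {direction k c}) (direction_mem k hc) := by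
      unfold param
      rw [dif_pos hc, dif_pos ht]
    have h1 := chart_param k hc
    rw [h] at h1 ⊢
    rw [blowUpGrad, h1]
  · rw [param_of_ne k hc ht, blowUpGrad, dF_signedPoint (by simpa using ht)
      (bary_mem k (abs_pos.2 ht) hc hc.2), chartGrad_of_ne k hc ht]

theorem contMDiff_blowUpGrad {n : ℕ} :
    ContMDiff 𝓘(ℝ, Vec n) 𝓘(ℝ, Vec n) ∞ (blowUpGrad (n := n)) := by
  intro z
  obtain ⟨k, c, hc, rfl⟩ := exists_param_eq z
  have h1 : ContMDiffOn 𝓘(ℝ, Vec n) 𝓘(ℝ, Vec n) ∞ (chartGrad k) (coordDomain n) :=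
    ContDiffOn.contMDiffOn fun c hc => (contDiffAt_chartGrad k hc).contDiffWithinAt
  have h2 : ContMDiffOn 𝓘(ℝ, Vec n) 𝓘(ℝ, Vec n) ∞ blowUpGrad (param k '' coordDomain n) := by
    refine (h1.comp (contMDiffOn_chartHomeo k) ?_).congr ?_
    · rintro _ ⟨c, hc, rfl⟩
      change chart k (param k c) ∈ coordDomain n
      rwa [chart_param k hc]
    · rintro _ ⟨c, hc, rfl⟩
      change _ = chartGrad k (chart k (param k c))
      rw [chart_param k hc, blowUpGrad_param k hc]
  exact h2.contMDiffAt ((chartHomeo k).open_source.mem_nhds ⟨c, hc, rfl⟩)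

theorem isSmoothExtension_blowUpGrad {n : ℕ} : IsSmoothExtension (blowUpGrad (n := n)) :=
  ⟨contMDiff_blowUpGrad, fun _ _ => rfl⟩

theorem IsSmoothExtension.eq {n : ℕ} {h h' : BlownUpCoamoeba n → Vec n}
    (hh : IsSmoothExtension h) (hh' : IsSmoothExtension h') : h = h' := by
  funext z
  rcases z with ⟨q, hq⟩ | ⟨k, l, hl⟩
  · rw [hh.2, hh'.2]
  · obtain ⟨c, hc, ht, hz⟩ := exists_param_eq_exc hl
    rw [← hz]
    have hdom := (isOpen_coordDomain n).mem_nhds hc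
    have hparam : ContinuousAt (param k) c := (contMDiffOn_param k).continuousOn.continuousAt hdom
    -- Moving only the coordinate `t` away from `0` leaves the exceptional fibre, so both extensions
    -- equal `dF` along this path and have the same limit.
    have hpath : Filter.Tendsto (fun s : ℝ => c + s • (Pi.single (Fin.last n) 1 : Vec n))
        (nhdsWithin 0 {0}ᶜ) (nhds c) := by
      have : ContinuousAt (fun s : ℝ => c + s • (Pi.single (Fin.last n) 1 : Vec n)) 0 := by fun_prop
      have h2 := this.tendsto
      rw [zero_smul, add_zero] at h2
      exact h2.mono_left nhdsWithin_le_nhds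
    have h1 := (hh.1.continuous.continuousAt.tendsto.comp hparam.tendsto).comp hpath
    have h2 := (hh'.1.continuous.continuousAt.tendsto.comp hparam.tendsto).comp hpath
    refine tendsto_nhds_unique_of_eventuallyEq h1 h2 ?_
    filter_upwards [hpath.eventually_mem hdom, self_mem_nhdsWithin] with s hs hs0
    simp only [Function.comp_apply]
    rw [param_of_ne k hs (by simpa [ht] using hs0), hh.2, hh'.2]

/-! ### The interior of `C⁺` -/

/-- The point of `C̃` over the point `[y]` of `int C⁺`. -/
noncomputable def posPoint {n : ℕ} (y : Vec n) : BlownUpCoamoeba n :=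
  param 0 (coords 0 1 ((2 / π) • complete y))

theorem posPoint_eq {n : ℕ} {y : Vec n} (hy : y ∈ openSimplex n) :
    posPoint y = .base (signedPoint 1 ((2 / π) • complete y))
      (signedPoint_mem (by decide) (smul_complete_mem (mem_openSimplex.1 hy))) :=
  param_coords 0 (by decide) (smul_complete_mem (mem_openSimplex.1 hy))

theorem proj_posPoint {n : ℕ} {y : Vec n} (hy : y ∈ openSimplex n) :
    (posPoint y).proj = toTorus y := by
  rw [posPoint_eq hy, BlownUpCoamoeba.proj, signedPoint, comb_smul_complete]
  simp

theorem posPoint_comb {n : ℕ} {b : Fin (n + 2) → ℝ} (hb : b ∈ openBary n) :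
    posPoint (comb b) = .base (signedPoint 1 b) (signedPoint_mem (by decide) hb) := by
  have : (2 / π) • complete (comb b) = b := by
    have := pi_pos.ne'
    rw [complete_comb hb.2, smul_smul]
    field_simp
    simp
  rw [posPoint, this, param_coords 0 (by decide) hb]

theorem blowUpGrad_posPoint {n : ℕ} {y : Vec n} (hy : y ∈ openSimplex n) :
    blowUpGrad (posPoint y) = grad y := by
  rw [posPoint_eq hy, blowUpGrad, dF_signedPoint (by decide)
    (smul_complete_mem (mem_openSimplex.1 hy)), comb_smul_complete]

theorem contMDiffOn_posPoint {n : ℕ} :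
    ContMDiffOn 𝓘(ℝ, Vec n) 𝓘(ℝ, Vec n) ∞ (posPoint (n := n)) (openSimplex n) := by
  have h1 : ContDiffOn ℝ ∞ (fun y : Vec n => coords 0 1 ((2 / π) • complete y)) (openSimplex n) := by
    intro y hy
    refine ContDiffAt.contDiffWithinAt (contDiffAt_pi.2 fun i => ?_)
    have hc : ∀ i, ContDiffAt ℝ ∞ (fun y : Vec n => ((2 / π) • complete y) i) y := fun i =>
      contDiffAt_const.mul (contDiff_complete i).contDiffAt
    refine Fin.lastCases ?_ (fun i => ?_) i
    · simp only [coords, Fin.snoc_last]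
      exact contDiffAt_const.mul (hc _)
    · simp only [coords, Fin.snoc_castSucc]
      exact (hc _).div (hc _) ((smul_complete_mem (mem_openSimplex.1 hy)).1 _).ne'
  exact (contMDiffOn_param 0).comp h1.contMDiffOn fun y hy =>
    coords_mem 0 (by decide) (smul_complete_mem (mem_openSimplex.1 hy))

theorem continuous_toTorus {n : ℕ} : Continuous (toTorus (n := n)) := continuous_quot_mk

theorem isOpen_toTorus_image {n : ℕ} : IsOpen (toTorus '' openSimplex n) :=
  QuotientAddGroup.isOpenMap_coe _ (isOpen_openSimplex n)

theorem vertex_add_smul_mem {n : ℕ} (k : Fin (n + 2)) {y : Vec n} (hy : y ∈ openSimplex n) {t : ℝ}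
    (h0 : 0 < t) (h1 : t < 1) : vertex k + t • (y - vertex k) ∈ openSimplex n := by
  rw [mem_openSimplex] at hy ⊢
  intro i
  have hv : 0 ≤ complete (vertex (n := n) k) i := by
    have : vertex (n := n) k = comb (Pi.single k 1) := by
      simp [comb, Pi.single_apply, ite_smul]
    rw [this, complete_comb (by simp)]
    exact mul_nonneg pi_div_two_pos.le (by rw [Pi.single_apply]; split_ifs <;> norm_num)
  rw [complete_add_smul, ← complete_sub_complete]
  simp only [Pi.add_apply, Pi.smul_apply, Pi.sub_apply, smul_eq_mul]
  nlinarith [hy i, mul_pos h0 (hy i), mul_nonneg (sub_nonneg.2 h1.le) hv]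

/-- Since `2 p_k` lies in the lattice, `p_k - t (y - p_k)` has the class of `-(p_k + t (y - p_k))`.
For small `t > 0` this lies in `C⁻` and not in `C⁺`, arbitrarily close to the vertex. -/
theorem vertex_notMem_interior {n : ℕ} (k : Fin (n + 2)) :
    toTorus (vertex k) ∉ interior (coamoebaPos n) := by
  intro h
  -- All slopes `1` and `s = 1 / (n + 2)` give the barycenter.
  obtain ⟨y, hy⟩ : (openSimplex n).Nonempty :=
    ⟨_, _, bary_mem (n := n) 0 (s := 1 / (n + 2)) (c := Fin.snoc (fun _ => 1) 0) (by positivity)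
      ⟨fun i => by simp, by simp⟩ (by
        simp [slope, Fin.sum_univ_castSucc]
        field_simp
        norm_num), rfl⟩
  have hc : ContinuousAt (fun t : ℝ => toTorus (vertex k - t • (y - vertex k))) 0 := by
    have : ContinuousAt (fun t : ℝ => (vertex k : Vec n) - t • (y - vertex k)) 0 := by fun_prop
    exact continuous_toTorus.continuousAt.comp this
  have h1 := hc.eventually_mem (by simpa using mem_interior_iff_mem_nhds.1 h)
  have h2 : ∀ᶠ t : ℝ in nhds 0, t < 1 := eventually_lt_nhds zero_lt_one
  obtain ⟨t, ⟨ht1, ht2⟩, ht0⟩ := (((h1.and h2).filter_mono nhdsWithin_le_nhds).and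
    (self_mem_nhdsWithin (s := Ioi (0 : ℝ)))).exists
  rw [toTorus_two_vertex] at ht1
  exact toTorus_neg_notMem (vertex_add_smul_mem k hy ht0 ht2) ht1

theorem posInterior_eq (n : ℕ) : posInterior n = posPoint '' openSimplex n := by
  refine Subset.antisymm ?_ ?_
  · rintro (⟨q, hq⟩ | ⟨k, l, hl⟩) hz
    · obtain ⟨σ, hσ, b, hb, rfl⟩ := exists_signedPoint hq
      cases σ
      · exact absurd rfl hσ
      · exact absurd (interior_subset hz) (signedPoint_neg_notMem hb)
      · exact ⟨comb b, ⟨b, hb, rfl⟩, posPoint_comb hb⟩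
    · exact absurd hz (vertex_notMem_interior k)
  · rintro _ ⟨y, hy, rfl⟩
    have : toTorus '' openSimplex n ⊆ interior (coamoebaPos n) :=
      interior_maximal (image_mono subset_union_right) isOpen_toTorus_image
    change (posPoint y).proj ∈ interior (coamoebaPos n)
    rw [proj_posPoint hy]
    exact this ⟨y, hy, rfl⟩

/-! ### The inverse diffeomorphism and the image of the extension -/

theorem posPoint_gradInv_blowUpGrad {n : ℕ} {z : BlownUpCoamoeba n} (hz : z ∈ posInterior n) :
    posPoint (gradInv (blowUpGrad z)) = z := by
  rw [posInterior_eq] at hz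
  obtain ⟨y, hy, rfl⟩ := hz
  rw [blowUpGrad_posPoint hy, gradInv_grad hy]

theorem blowUpGrad_posPoint_gradInv {n : ℕ} {x : Vec n} (hx : x ∈ strictAmoeba n) :
    blowUpGrad (posPoint (gradInv x)) = x := by
  rw [← image_grad] at hx
  rw [blowUpGrad_posPoint (gradInv_mem hx), grad_gradInv hx]

theorem contMDiffOn_posPoint_gradInv {n : ℕ} :
    ContMDiffOn 𝓘(ℝ, Vec n) 𝓘(ℝ, Vec n) ∞ (fun x : Vec n => posPoint (gradInv x))
      (strictAmoeba n) := by
  have h1 : ContDiffOn ℝ ∞ (gradInv (n := n)) (strictAmoeba n) := fun x hx =>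
    (contDiffAt_gradInv (by rwa [image_grad])).contDiffWithinAt
  exact contMDiffOn_posPoint.comp h1.contMDiffOn fun x hx => gradInv_mem (by rwa [image_grad])

/-- The topology of the blow-up comes from its atlas, so continuity is checked in the charts, where
the projection is `[p_k + t v]` also at `t = 0`. It makes `posInterior` open. -/
theorem continuous_proj {n : ℕ} : Continuous (BlownUpCoamoeba.proj (n := n)) := by
  rw [continuous_iff_continuousAt]
  intro z
  obtain ⟨k, c, hc, rfl⟩ := exists_param_eq z
  have hproj : ∀ c ∈ coordDomain n, (param k c).proj =
      toTorus (vertex k + c (Fin.last n) • direction k c) := by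
    intro c hc
    unfold param
    rw [dif_pos hc]
    split_ifs with ht
    · simp [BlownUpCoamoeba.proj, ht]
    · rfl
  have h1 : Continuous fun c : Vec n => toTorus (vertex k + c (Fin.last n) • direction k c) := by
    have : ∀ i, Continuous fun c : Vec n => slope c i := fun i => (contDiff_slope i).continuous
    refine continuous_toTorus.comp ?_
    unfold direction
    fun_prop
  have h2 : ContinuousOn BlownUpCoamoeba.proj (chartHomeo (n := n) k).source := by
    refine (h1.comp_continuousOn (chartHomeo k).continuousOn).congr ?_
    rintro _ ⟨c, hc, rfl⟩
    change _ = (fun c : Vec n => toTorus (vertex k + c (Fin.last n) • direction k c))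
      (chart k (param k c))
    rw [chart_param k hc, hproj c hc]
  exact h2.continuousAt ((chartHomeo k).open_source.mem_nhds ⟨c, hc, rfl⟩)

/-- The restriction of the extended map to `int C⁺`. -/
noncomputable def posInteriorHomeo (n : ℕ) :
    OpenPartialHomeomorph (BlownUpCoamoeba n) (Vec n) where
  toFun := blowUpGrad
  invFun x := posPoint (gradInv x)
  source := posInterior n
  target := strictAmoeba n
  map_source' z hz := by
    rw [posInterior_eq] at hz
    obtain ⟨y, hy, rfl⟩ := hz
    rw [blowUpGrad_posPoint hy]
    exact grad_mem_strictAmoeba hy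
  map_target' x hx := by
    rw [posInterior_eq]
    exact ⟨_, gradInv_mem (by rwa [image_grad]), rfl⟩
  left_inv' _ hz := posPoint_gradInv_blowUpGrad hz
  right_inv' _ hx := blowUpGrad_posPoint_gradInv hx
  open_source := isOpen_interior.preimage continuous_proj
  open_target := by
    rw [← interior_amoeba]
    exact isOpen_interior
  continuousOn_toFun := contMDiff_blowUpGrad.continuous.continuousOn
  continuousOn_invFun := contMDiffOn_posPoint_gradInv.continuousOn

/-- The non-exceptional points cover exactly the strict region, and the exceptional fibres supply
the points where the gap product attains the bound. -/
theorem range_blowUpGrad (n : ℕ) : range (blowUpGrad (n := n)) = amoeba n := by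
  refine Subset.antisymm ?_ fun x hx => ?_
  · rintro _ ⟨⟨q, hq⟩ | ⟨k, l, hl⟩, rfl⟩
    · obtain ⟨σ, hσ, b, hb, rfl⟩ := exists_signedPoint hq
      rw [blowUpGrad, dF_signedPoint hσ hb]
      exact strictAmoeba_subset (grad_mem_strictAmoeba ⟨b, hb, rfl⟩)
    · obtain ⟨c, hc, ht, hz⟩ := exists_param_eq_exc hl
      rw [← hz, blowUpGrad_param k hc]
      exact chartGrad_mem_amoeba k hc ht
  · by_cases h : x ∈ strictAmoeba n
    · exact ⟨_, blowUpGrad_posPoint_gradInv h⟩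
    · obtain ⟨k, c, hc, -, rfl⟩ := exists_chartGrad_eq hx h
      exact ⟨_, blowUpGrad_param k hc⟩

end LagrangianPants

theorem mainTheorem2 (n : ℕ) (hn : n = 1 ∨ n = 2) :
    ∃ h : BlownUpCoamoeba n → Vec n,
      IsSmoothExtension h ∧
      (∀ h' : BlownUpCoamoeba n → Vec n, IsSmoothExtension h' → h' = h) ∧
      range h = amoeba n ∧
      ∃ e : OpenPartialHomeomorph (BlownUpCoamoeba n) (Vec n),
        e.source = posInterior n ∧
        e.target = interior (amoeba n) ∧
        EqOn e h e.source ∧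
        ContMDiffOn 𝓘(ℝ, Vec n) 𝓘(ℝ, Vec n) ∞ e e.source ∧
        ContMDiffOn 𝓘(ℝ, Vec n) 𝓘(ℝ, Vec n) ∞ e.symm e.target :=
  ⟨blowUpGrad, isSmoothExtension_blowUpGrad, fun _ h' => h'.eq isSmoothExtension_blowUpGrad,
    range_blowUpGrad n, posInteriorHomeo n, rfl, (interior_amoeba n).symm, fun _ _ => rfl,
    contMDiff_blowUpGrad.contMDiffOn, contMDiffOn_posPoint_gradInv⟩
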